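/- Let $\mathcal A$ be a unital $C^*$-algebra, $1\in\mathcal B\subset\mathcal A$ a unital $C^*$-subalgebra and $E:\mathcal A\to\mathcal B$ a positive conditional expectation, i.e. $E$ is linear, $E[1]=1$, $E[bab']=bE[a]b'$ for $a\in\mathcal A$, $b,b'\in\mathcal B$, and for every $a\in\mathcal A$ there is $b\in\mathcal B$ with $E[a^*a]=b^*b$. Let $\mathcal B\langle x\rangle$ be the $*$-algebra of polynomials in a formal variable $x=x^*$ with coefficients in $\mathcal B$ (the free product of $\mathcal B$ and $\mathbb C\langle x\rangle$ with amalgamation over $\mathbb C$), spanned by the monomials $b_0xb_1x\cdots xb_k$. For $X=X^*\in\mathcal A$ let $\mu_X:\mathcal B\langle x\rangle\to\mathcal B$, $\mu_X(p)=E[p(X)]$, be its distribution. Let $\Sigma_{\mathcal B}^0$ be the set of all linear maps $\mu:\mathcal B\langle x\rangle\to\mathcal B$ such that $\mu(1)=1$; $\mu(bpb')=b\mu(p)b'$ for $b,b'\in\mathcal B$; $(\mathrm{id}\otimes\mu)(p^*p)\ge 0$ for all $n$ and all $p\in M_n(\mathcal B\langle x\rangle)$; and, for some $M>0$, $\|\mu(xb_1x\cdots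 b_nx)\|\le M^{n+1}\|b_1\|\cdots\|b_n\|$ for all $n\ge 0$ and $b_1,\dots,b_n\in\mathcal B$. Random variables $X_i\in\mathcal A$ are free if the subalgebras $\mathcal B\langle X_i\rangle$ generated by $\mathcal B$ and $X_i$ are free over $\mathcal B$: $E[a_1\cdots a_k]=0$ whenever $k\ge1$, $a_j\in\mathcal B\langle X_{i_j}\rangle$, $E[a_j]=0$ for all $j$, and $i_1\ne i_2\ne\dots\ne i_k$ (neighbouring indices are different). They are identically distributed if all $\mu_{X_i}$ coincide. For a non-crossing pairing $\pi\in NC_2(k)$ of $\{1,\dots,k\}$ and a map $\eta:\mathcal B\to\mathcal B$, let $\eta_\pi(b_1,\dots,b_{k-1})$ be the element of $\mathcal B$ obtained from the word $xb_1xb_2\cdots b_{k-1}x$ by replacing each pair of $\pi$, together with the already evaluated expression $c$ between its two letters $x$, by $\eta(c)$, respecting the nesting of the pairs; e.g. $\eta_{\{\{1,2\},\{3,4\}\}}(b_1,b_2,b_3)=\eta(b_1)b_2\eta(b_3)$ and $\eta_{\{\{1,4\},\{2,3\}\}}(b_1,b_2,b_3)=\eta(b_1\eta(b_2)b_3)$.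 **Theorem (operator-valued free central limit theorem).** Let $X_1,X_2,\dots\in\mathcal A$ be selfadjoint, free and identically distributed, with $E[X_i]=0$ for all $i$ and $E[X_ibX_i]=\eta(b)$ for all $i$ and all $b\in\mathcal B$, for a completely positive map $\eta:\mathcal B\to\mathcal B$. Put $S_N:=(X_1+\cdots+X_N)/\sqrt N$. Then there is a unique $\nu_\eta\in\Sigma_{\mathcal B}^0$ (the $\mathcal B$-valued semicircular distribution with covariance $\eta$) such that $$\nu_\eta(b_0xb_1x\cdots b_{k-1}xb_k)=\sum_{\pi\in NC_2(k)}b_0\,\eta_\pi(b_1,\dots,b_{k-1})\,b_k$$ for all $k\ge1$ and $b_0,\dots,b_k\in\mathcal B$; in particular all odd moments ($k$ odd) of $\nu_\eta$ vanish. Moreover $S_N$ converges in distribution to $\nu_\eta$: for every $p\in\mathcal B\langle x\rangle$, $\|\mu_{S_N}(p)-\nu_\eta(p)\|\to0$ as $N\to\infty$. -/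

import Mathlib

noncomputable section

/-! ### The polynomial algebra `B⟨x⟩` -/

namespace BPoly

/-- Defining relations of `B⟨x⟩`, the free product of `B` and `ℂ⟨x⟩` with amalgamation over `ℂ`.
Generators: `some b` for the coefficients `b : B`, and `none` for the formal variable `x`. -/
inductive Rel (B : Type*) [Ring B] [Algebra ℂ B] :
    FreeAlgebra ℂ (Option B) → FreeAlgebra ℂ (Option B) → Prop
  | add (b c : B) : Rel B (FreeAlgebra.ι ℂ (some (b + c)))
      (FreeAlgebra.ι ℂ (some b) + FreeAlgebra.ι ℂ (some c))
  | mul (b c : B) : Rel B (FreeAlgebra.ι ℂ (some (b * c)))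
      (FreeAlgebra.ι ℂ (some b) * FreeAlgebra.ι ℂ (some c))
  | scalar (z : ℂ) : Rel B (FreeAlgebra.ι ℂ (some (algebraMap ℂ B z)))
      (algebraMap ℂ (FreeAlgebra ℂ (Option B)) z)

end BPoly

/-- `B⟨x⟩`: polynomials in one formal variable `x` with coefficients in the (noncommutative)
unital algebra `B`, where `x` does not commute with the coefficients. -/
def BPoly (B : Type*) [Ring B] [Algebra ℂ B] : Type _ := RingQuot (BPoly.Rel B)

namespace BPoly

section Basic

variable {B : Type*} [Ring B] [Algebra ℂ B]

instance : Ring (BPoly B) := inferInstanceAs (Ring (RingQuot (BPoly.Rel B)))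

instance : Algebra ℂ (BPoly B) := inferInstanceAs (Algebra ℂ (RingQuot (BPoly.Rel B)))

/-- The quotient map from the free algebra. -/
def mk : FreeAlgebra ℂ (Option B) →ₐ[ℂ] BPoly B := RingQuot.mkAlgHom ℂ (BPoly.Rel B)

/-- The formal variable `x`. -/
def x : BPoly B := mk (FreeAlgebra.ι ℂ none)

theorem mk_rel {p q : FreeAlgebra ℂ (Option B)} (h : Rel B p q) : mk p = mk q :=
  RingQuot.mkAlgHom_rel ℂ h

/-- The inclusion of the constant polynomials `B → B⟨x⟩`. -/
def C : B →ₐ[ℂ] BPoly B where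
  toFun b := mk (FreeAlgebra.ι ℂ (some b))
  map_one' := by simpa only [map_one] using mk_rel (Rel.scalar (B := B) 1)
  map_mul' b c := by simpa only [map_mul] using mk_rel (Rel.mul b c)
  map_zero' := by simpa only [map_zero] using mk_rel (Rel.scalar (B := B) 0)
  map_add' b c := by simpa only [map_add] using mk_rel (Rel.add b c)
  commutes' z := by simpa only [AlgHom.commutes] using mk_rel (Rel.scalar (B := B) z)

/-- Universal property: evaluation `p(x) ↦ p(a)`, with the coefficients mapped by `f`. -/
def eval {A : Type*} [Ring A] [Algebra ℂ A] (f : B →ₐ[ℂ] A) (a : A) : BPoly B →ₐ[ℂ] A :=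
  RingQuot.liftAlgHom ℂ ⟨FreeAlgebra.lift ℂ (fun o : Option B => o.elim a f), by
    intro p q h
    cases h <;> simp⟩

theorem eval_mk {A : Type*} [Ring A] [Algebra ℂ A] (f : B →ₐ[ℂ] A) (a : A)
    (q : FreeAlgebra ℂ (Option B)) :
    eval f a (mk q) = FreeAlgebra.lift ℂ (fun o : Option B => o.elim a f) q :=
  RingQuot.liftAlgHom_mkAlgHom_apply ℂ _ _ q

@[simp] theorem eval_x {A : Type*} [Ring A] [Algebra ℂ A] (f : B →ₐ[ℂ] A) (a : A) :
    eval f a x = a := by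
  rw [x, eval_mk, FreeAlgebra.lift_ι_apply]; rfl

@[simp] theorem eval_C {A : Type*} [Ring A] [Algebra ℂ A] (f : B →ₐ[ℂ] A) (a : A) (b : B) :
    eval f a (C b) = f b := by
  change eval f a (mk (FreeAlgebra.ι ℂ (some b))) = f b
  rw [eval_mk, FreeAlgebra.lift_ι_apply]; rfl

theorem induction {motive : BPoly B → Prop} (const : ∀ b, motive (C b)) (var : motive x)
    (add : ∀ p q, motive p → motive q → motive (p + q))
    (mul : ∀ p q, motive p → motive q → motive (p * q)) (p : BPoly B) : motive p := by
  obtain ⟨q, rfl⟩ := RingQuot.mkAlgHom_surjective ℂ (BPoly.Rel B) p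
  change motive (mk q)
  induction q using FreeAlgebra.induction with
  | grade0 z =>
    have h := const (algebraMap ℂ B z)
    rwa [AlgHom.commutes, ← AlgHom.commutes mk] at h
  | grade1 o =>
    cases o with
    | none => exact var
    | some b => exact const b
  | mul p q hp hq => rw [map_mul]; exact mul _ _ hp hq
  | add p q hp hq => rw [map_add]; exact add _ _ hp hq

/-- The monomial `b₀ x b₁ x b₂ ⋯ x b_k` (only `b 0, …, b k` matter). -/
def monomial (k : ℕ) (b : ℕ → B) : BPoly B :=
  C (b 0) * ((List.range k).map fun j => x * C (b (j + 1))).prod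

end Basic

section Star

/-- The opposite of the ring `R`, with complex scalars acting through complex conjugation.
An algebra homomorphism into it is a conjugate-linear antihomomorphism into `R`. -/
def ConjOp (R : Type*) : Type _ := Rᵐᵒᵖ

instance (R : Type*) [Ring R] : Ring (ConjOp R) := inferInstanceAs (Ring Rᵐᵒᵖ)

instance (R : Type*) [Ring R] [Algebra ℂ R] : Algebra ℂ (ConjOp R) :=
  ((algebraMap ℂ Rᵐᵒᵖ).comp (starRingEnd ℂ)).toAlgebra'
    (fun z (r : Rᵐᵒᵖ) => Algebra.commutes (A := Rᵐᵒᵖ) (starRingEnd ℂ z) r)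

variable {B : Type*} [Ring B] [StarRing B] [Algebra ℂ B] [StarModule ℂ B]

/-- The map `b ↦ b*`, from `B` to the constant polynomials, as an antihomomorphism. -/
def starC : B →ₐ[ℂ] ConjOp (BPoly B) where
  toFun b := MulOpposite.op (C (star b))
  map_one' := by rw [star_one, map_one]; rfl
  map_mul' b c := by rw [star_mul, map_mul]; rfl
  map_zero' := by rw [star_zero, map_zero]; rfl
  map_add' b c := by rw [star_add, map_add]; rfl
  commutes' z := by
    rw [← algebraMap_star_comm, AlgHom.commutes]; rfl

/-- The conjugate-linear antihomomorphism of `B⟨x⟩` with `b ↦ b*` and `x ↦ x`. -/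
def starHom : BPoly B →ₐ[ℂ] ConjOp (BPoly B) := eval starC (MulOpposite.op x)

/-- The `*`-structure of `B⟨x⟩` with `x* = x`, i.e.
`(b₀ x b₁ ⋯ x b_k)* = b_k* x ⋯ b₁* x b₀*`. -/
instance : Star (BPoly B) := ⟨fun p => MulOpposite.unop (starHom p)⟩

theorem star_C (b : B) : star (C b : BPoly B) = C (star b) :=
  congrArg MulOpposite.unop (eval_C starC (MulOpposite.op x) b)

theorem star_x : star (x : BPoly B) = x :=
  congrArg MulOpposite.unop (eval_x starC (MulOpposite.op x))

theorem star_add' (p q : BPoly B) : star (p + q) = star p + star q :=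
  congrArg MulOpposite.unop (map_add starHom p q)

theorem star_mul' (p q : BPoly B) : star (p * q) = star q * star p :=
  congrArg MulOpposite.unop (map_mul starHom p q)

instance : StarRing (BPoly B) where
  star_involutive p := by
    induction p using BPoly.induction with
    | const b => rw [star_C, star_C, star_star]
    | var => rw [star_x, star_x]
    | add p q hp hq => rw [star_add', star_add', hp, hq]
    | mul p q hp hq => rw [star_mul', star_mul', hp, hq]
  star_mul := star_mul'
  star_add := star_add'

end Star

end BPoly

/-! ### `B`-valued distributions -/

/-- `μ ∈ Σ_B`: a unital, `B`-`B`-bimodular, completely positive linear map `μ : B⟨x⟩ → B`. -/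
structure IsBDistribution {B : Type*} [CStarAlgebra B] [PartialOrder B] [StarOrderedRing B]
    (μ : BPoly B →ₗ[ℂ] B) : Prop where
  map_one : μ 1 = 1
  bimodule : ∀ (b : B) (p : BPoly B) (b' : B), μ (BPoly.C b * p * BPoly.C b') = b * μ p * b'
  completelyPositive : ∀ (n : ℕ) (p : Matrix (Fin n) (Fin n) (BPoly B)),
    0 ≤ CStarMatrix.ofMatrix ((p.conjTranspose * p).map μ)

/-- `μ ∈ Σ_B⁰`: a `B`-valued distribution which is exponentially bounded, i.e.
`‖μ(x b₁ x b₂ ⋯ x bₙ x)‖ ≤ M ^ (n + 1) ‖b₁‖ ⋯ ‖bₙ‖` for some `M > 0`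
(here `b₁, …, bₙ` are `b 0, …, b (n - 1)`). -/
structure IsBoundedBDistribution {B : Type*} [CStarAlgebra B] [PartialOrder B]
    [StarOrderedRing B] (μ : BPoly B →ₗ[ℂ] B) : Prop extends IsBDistribution μ where
  expBounded : ∃ M : ℝ, 0 < M ∧ ∀ (n : ℕ) (b : ℕ → B),
    ‖μ (((List.range n).map fun j => BPoly.x * BPoly.C (b j)).prod * BPoly.x)‖
      ≤ M ^ (n + 1) * ∏ j ∈ Finset.range n, ‖b j‖

/-! ### Operator-valued `C*`-probability spaces, distributions, freeness -/

/-- A `B`-valued `C*`-probability space `(A, B, E)`: the unital `C*`-algebra `B` is a unital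
`C*`-subalgebra of `A` (through the injective unital `*`-homomorphism `incl`), and `E : A → B` is
a positive conditional expectation. -/
structure OpValuedCStarProbSpace (A B : Type*) [CStarAlgebra A] [CStarAlgebra B] where
  incl : B →⋆ₐ[ℂ] A
  incl_injective : Function.Injective incl
  E : A →ₗ[ℂ] B
  E_one : E 1 = 1
  E_bimodule : ∀ (b : B) (a : A) (b' : B), E (incl b * a * incl b') = b * E a * b'
  E_positive : ∀ a : A, ∃ b : B, E (star a * a) = star b * b

namespace OpValuedCStarProbSpace

variable {A B : Type*} [CStarAlgebra A] [CStarAlgebra B]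

/-- The distribution `μ_X : B⟨x⟩ → B`, `μ_X(p) = E[p(X)]`. -/
def distribution (P : OpValuedCStarProbSpace A B) (X : A) : BPoly B →ₗ[ℂ] B :=
  P.E ∘ₗ (BPoly.eval (P.incl : B →ₐ[ℂ] A) X).toLinearMap

/-- Freeness with amalgamation over `B` of subalgebras `B ⊆ S i ⊆ A`: the expectation of a
product of centred elements is zero if neighbouring factors come from different subalgebras. -/
def FreeSubalgebras (P : OpValuedCStarProbSpace A B) {I : Type*} (S : I → Subalgebra ℂ A) : Prop :=
  (∀ i b, P.incl b ∈ S i) ∧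
  ∀ (k : ℕ) (i : Fin (k + 1) → I) (a : Fin (k + 1) → A),
    (∀ j, a j ∈ S (i j)) → (∀ j, P.E (a j) = 0) →
    (∀ j : Fin k, i j.castSucc ≠ i j.succ) →
    P.E (List.ofFn a).prod = 0

/-- `B⟨X⟩`, the subalgebra of `A` generated by `B` and `X`. -/
def generated (P : OpValuedCStarProbSpace A B) (X : A) : Subalgebra ℂ A :=
  Algebra.adjoin ℂ (Set.range P.incl ∪ {X})

/-- Random variables `X i` are free if the subalgebras `B⟨X i⟩` are free. -/
def IsFree (P : OpValuedCStarProbSpace A B) {I : Type*} (X : I → A) : Prop :=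
  P.FreeSubalgebras fun i => P.generated (X i)

/-- The normalized sum `S_N = (X_1 + ⋯ + X_N) / √N` of a sequence (indexed from zero). -/
def normalizedSum (X : ℕ → A) (N : ℕ) : A :=
  ((√(N : ℝ) : ℝ) : ℂ)⁻¹ • ∑ i ∈ Finset.range N, X i

end OpValuedCStarProbSpace

/-! ### Non-crossing pairings and the semicircular distribution -/

/-- `NC₂(k)`: the non-crossing pairings of `{0, …, k - 1}`. A pairing is given by the
fixed-point-free involution which exchanges the two elements of each block; it is non-crossing
if there are no positions `i < j < σ i < σ j`. -/
def NCPairings (k : ℕ) : Finset (Equiv.Perm (Fin k)) :=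
  Finset.univ.filter fun σ =>
    (∀ i, σ i ≠ i) ∧ (∀ i, σ (σ i) = i) ∧ ∀ i j, ¬ (i < j ∧ j < σ i ∧ σ i < σ j)

/-- The position paired with position `i` (with the value `i` outside the range). -/
def pairPartner {k : ℕ} (σ : Equiv.Perm (Fin k)) (i : ℕ) : ℕ :=
  if h : i < k then (σ ⟨i, h⟩ : ℕ) else i

/-- The nested evaluation of the segment
`b_lo x_lo b_{lo+1} x_{lo+1} ⋯ x_{hi-1} b_hi`, where the variables at the positions
`lo, …, hi - 1` are paired by `s` in a non-crossing way. If the segment is not just `b_lo`, the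
variable `x_lo` is paired with `x_j`, `j = s lo`; this block together with the nested evaluation
`c` of everything inside of it contributes `η c`:
`b_lo · η(b_{lo+1} x_{lo+1} ⋯ x_{j-1} b_j) · (b_{j+1} x_{j+1} ⋯ x_{hi-1} b_hi)`. -/
def nestedEval {B : Type*} [Mul B] (η : B → B) (s : ℕ → ℕ) (b : ℕ → B) (lo hi : ℕ) : B :=
  if _h : lo < s lo ∧ s lo < hi then
    b lo * η (nestedEval η s b (lo + 1) (s lo)) * nestedEval η s b (s lo + 1) hi
  else b lo
termination_by hi - lo
decreasing_by all_goals omega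

/-- `η_π(b₁, …, b_{k-1})` for a non-crossing pairing `π` of `k` points: the word
`x b₁ x b₂ ⋯ b_{k-1} x` evaluated by replacing each block by `η`, respecting the nesting of the
blocks. Only the values `b 1, …, b (k - 1)` are used; the outer coefficients are set to `1`. -/
def etaPairing {B : Type*} [Monoid B] (η : B → B) {k : ℕ} (π : Equiv.Perm (Fin k))
    (b : ℕ → B) : B :=
  nestedEval η (pairPartner π) (fun j => if 0 < j ∧ j < k then b j else 1) 0 k

/-- `ν` is the `B`-valued semicircular distribution `ν_η` with covariance `η`: it lies in `Σ_B⁰`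
and `ν(b₀ x b₁ ⋯ x b_k) = ∑_{π ∈ NC₂(k)} b₀ η_π(b₁, …, b_{k-1}) b_k`. -/
structure IsSemicircularDistribution {B : Type*} [CStarAlgebra B] [PartialOrder B]
    [StarOrderedRing B] (η : CompletelyPositiveMap B B) (ν : BPoly B →ₗ[ℂ] B) : Prop
    extends IsBoundedBDistribution ν where
  moments : ∀ (k : ℕ) (b : ℕ → B), 1 ≤ k →
    ν (BPoly.monomial k b) = ∑ π ∈ NCPairings k, b 0 * etaPairing η π b * b k

end

/-! ### Complete positivity of distributions -/

/-! Expanding a moment of order `k` of the normalized sum gives `N^(-k/2)` times a sum, over index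
functions `i : Fin k → Fin N`, of expectations of words in the `X i`. By freeness and identical
distribution such an expectation depends only on which indices coincide (`IsFree.E_segmentWord_eq`),
and it is zero if some index occurs exactly once (`IsFree.E_segmentWord_eq_zero`). If every index is
repeated and the coincidences do not form a pairing, fewer than `k/2` values are taken; such
functions are too few to survive the normalization. A given pairing is the kernel of
`N(N-1)⋯(N-k/2+1)` functions, so its weight tends to `1` (`tendsto_normalized_sum_pairings`).

It remains to evaluate a word whose coincidences form a pairing. The block of the first letter can
be peeled off: `E[X v X w] = η(E[v]) E[w]` when the index of `X` occurs in neither `v` nor `w`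
(`IsFree.E_X_mul_X_mul`). Iterating this yields the nested evaluation for non-crossing pairings. At
a crossing, the enclosed word contains an index whose partner lies outside, and the expectation is
zero.

The distribution `ν` is taken to be the pointwise limit, so linearity, the bimodule property and
complete positivity are inherited from the distributions of the sums. The exponential bound comes
from the boundedness of `η` and from there being at most `2^k` non-crossing pairings. Uniqueness
holds because monomials span. -/

theorem exists_nonneg_sub_star_mul_self {D : Type*} [CStarAlgebra D] [PartialOrder D]
    [StarOrderedRing D] (a : D) (ha : IsSelfAdjoint a) :
    ∃ q r c : D, 0 ≤ q ∧ r = star c * c ∧ q - r = a ∧ r * q = 0 := by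
  obtain ⟨c, hc⟩ := CStarAlgebra.nonneg_iff_eq_star_mul_self.mp (CFC.negPart_nonneg a)
  exact ⟨a⁺, a⁻, c, CFC.posPart_nonneg a, hc, CFC.posPart_sub_negPart a ha,
    CFC.negPart_mul_posPart a⟩

/-- A selfadjoint matrix over a `C*`-algebra is positive if all its quadratic forms are. -/
theorem CStarMatrix.nonneg_of_forall_quadratic {n B : Type*} [Fintype n] [DecidableEq n]
    [CStarAlgebra B] [PartialOrder B] [StarOrderedRing B] (M : CStarMatrix n n B)
    (hM : IsSelfAdjoint M)
    (h : ∀ v : n → B, 0 ≤ ∑ i, ∑ j, star (v i) * M i j * v j) : 0 ≤ M := by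
  obtain ⟨q, r, c, hq, hc, hdiff, hrq⟩ := exists_nonneg_sub_star_mul_self M hM
  have hN : star r = r := by rw [hc, star_mul, star_star]
  -- `r` is the negative part of `M`. Testing `M` on the columns of `r` gives the diagonal of `r M r
  -- = -r³`; being nonnegative, it is zero, so all entries of `c r` vanish and `r² = c* (c r) = 0`.
  have hNMN : r * M * r = -(star (c * r) * (c * r)) := by
    rw [← hdiff, mul_sub, hrq, star_mul, hN, zero_sub, neg_mul, neg_inj,
      mul_assoc r (star c), ← mul_assoc (star c), ← hc, mul_assoc]
  have hentry : ∀ j i, (c * r) i j = 0 := by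
    intro j
    have h1 : ∑ i, star ((c * r) i j) * (c * r) i j ≤ 0 := by
      have h2 := h fun i => r i j
      have h3 : ∑ i, ∑ k, star (r i j) * M i k * r k j = (r * M * r) j j := by
        simp only [CStarMatrix.mul_apply, Finset.sum_mul]
        rw [Finset.sum_comm]
        refine Finset.sum_congr rfl fun k _ => Finset.sum_congr rfl fun i _ => ?_
        rw [← CStarMatrix.star_apply, hN]
      rw [h3, hNMN, CStarMatrix.neg_apply] at h2
      have h4 := neg_nonneg.mp h2
      rwa [CStarMatrix.mul_apply] at h4
    have h5 : ∀ i, 0 ≤ star ((c * r) i j) * (c * r) i j := fun i => star_mul_self_nonneg _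
    have h6 := le_antisymm h1 (Finset.sum_nonneg fun i _ => h5 i)
    intro i
    have h7 := (Finset.sum_eq_zero_iff_of_nonneg fun i _ => h5 i).mp h6 i (Finset.mem_univ i)
    exact (CStarRing.star_mul_self_eq_zero_iff _).mp h7
  have hzero : c * r = 0 := CStarMatrix.ext fun i j => hentry j i
  have hN0 : r = 0 := by
    rw [← CStarRing.star_mul_self_eq_zero_iff, hN]
    conv_lhs => enter [1]; rw [hc]
    rw [mul_assoc, hzero, mul_zero]
  rw [← hdiff, hN0, sub_zero]
  exact hq

theorem BPoly.eval_star {A B : Type*} [Ring A] [StarRing A] [Algebra ℂ A] [Ring B] [StarRing B]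
    [Algebra ℂ B] [StarModule ℂ B] (f : B →⋆ₐ[ℂ] A) {a : A} (ha : IsSelfAdjoint a)
    (p : BPoly B) :
    BPoly.eval (f : B →ₐ[ℂ] A) a (star p) = star (BPoly.eval (f : B →ₐ[ℂ] A) a p) := by
  induction p using BPoly.induction with
  | const b => rw [BPoly.star_C, BPoly.eval_C, BPoly.eval_C]; exact map_star f b
  | var => rw [BPoly.star_x, BPoly.eval_x, ha.star_eq]
  | add p q hp hq => rw [star_add, map_add, map_add, star_add, hp, hq]
  | mul p q hp hq => rw [star_mul, map_mul, map_mul, star_mul, hp, hq]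

namespace OpValuedCStarProbSpace

variable {A B : Type*} [CStarAlgebra A] [CStarAlgebra B] (P : OpValuedCStarProbSpace A B)

theorem E_incl_mul (b : B) (a : A) : P.E (P.incl b * a) = b * P.E a := by
  simpa using P.E_bimodule b a 1

theorem E_mul_incl (a : A) (b : B) : P.E (a * P.incl b) = P.E a * b := by
  simpa using P.E_bimodule 1 a b

theorem E_incl (b : B) : P.E (P.incl b) = b := by
  simpa [P.E_one] using P.E_incl_mul b 1

theorem star_E_star_mul_self (a : A) : star (P.E (star a * a)) = P.E (star a * a) := by
  obtain ⟨b, hb⟩ := P.E_positive a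
  rw [hb, star_mul, star_star]

/-- Positivity only makes `E[a* a]` selfadjoint. Applied to `a + 1`, this makes `E[a] + E[a*]`
selfadjoint; combining the cases `a` and `i a` separates the two summands. -/
theorem star_E (a : A) : star (P.E a) = P.E (star a) := by
  have key : ∀ a : A, star (P.E a) + star (P.E (star a)) = P.E a + P.E (star a) := by
    intro a
    have h1 := P.star_E_star_mul_self (a + 1)
    have h2 := P.star_E_star_mul_self a
    simp only [star_add, star_one, mul_add, add_mul, mul_one, one_mul, map_add, P.E_one] at h1
    rw [h2] at h1
    have h3 : star (P.E a) + star (P.E (star a)) + (P.E (star a * a) + 1)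
      = P.E a + P.E (star a) + (P.E (star a * a) + 1) := by
      linear_combination (norm := module) h1
    exact add_right_cancel h3
  have h1 := key a
  have h2 := key (Complex.I • a)
  simp only [star_smul, map_smul, Complex.star_def, Complex.conj_I, neg_smul, map_neg,
    star_neg] at h2
  have h3 := congrArg (fun z => Complex.I • z) h2
  simp only [smul_add, smul_neg, smul_smul, Complex.I_mul_I, neg_smul, one_smul, neg_neg] at h3
  have h4 : (2 : ℂ) • star (P.E a) = (2 : ℂ) • P.E (star a) := by
    rw [two_smul, two_smul]
    linear_combination (norm := module) h1 + h3
  exact smul_right_injective B (two_ne_zero' ℂ) h4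

variable [PartialOrder B] [StarOrderedRing B]

theorem E_star_mul_self_nonneg (a : A) : 0 ≤ P.E (star a * a) := by
  obtain ⟨b, hb⟩ := P.E_positive a
  rw [hb]
  exact star_mul_self_nonneg b

/-- A conditional expectation is completely positive. -/
theorem gram_nonneg {m n : Type*} [Fintype m] [Fintype n] [DecidableEq n] (a : m → n → A) :
    0 ≤ CStarMatrix.ofMatrix (Matrix.of fun i j => P.E (∑ k, star (a k i) * a k j)) := by
  apply CStarMatrix.nonneg_of_forall_quadratic
  · refine CStarMatrix.ext fun i j => ?_
    rw [CStarMatrix.star_apply]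
    change star (P.E _) = P.E _
    rw [P.star_E]
    simp
  · intro v
    -- Bimodularity moves the test vector inside `E`, turning the quadratic form into a sum of
    -- values `E[c* c]`.
    have h : ∑ i, ∑ j, star (v i) * P.E (∑ k, star (a k i) * a k j) * v j
        = ∑ k, P.E (star (∑ j, a k j * P.incl (v j)) * ∑ j, a k j * P.incl (v j)) := by
      simp only [star_sum, Finset.sum_mul, Finset.mul_sum, map_sum, star_mul]
      rw [Finset.sum_comm]
      conv_rhs => rw [Finset.sum_comm]
      conv_rhs => enter [2, i]; rw [Finset.sum_comm]
      refine Finset.sum_congr rfl fun i _ => Finset.sum_congr rfl fun j _ =>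
        Finset.sum_congr rfl fun k _ => ?_
      rw [← P.E_bimodule, map_star]
      simp only [mul_assoc]
    change 0 ≤ ∑ i, ∑ j, star (v i) * P.E (∑ k, star (a k i) * a k j) * v j
    rw [h]
    exact Finset.sum_nonneg fun k _ => P.E_star_mul_self_nonneg _

theorem isBDistribution_distribution {X : A} (hX : IsSelfAdjoint X) :
    IsBDistribution (P.distribution X) where
  map_one := by simp [distribution, P.E_one]
  bimodule b p b' := by simp [distribution, P.E_bimodule]
  completelyPositive n p := by
    convert P.gram_nonneg fun k i => BPoly.eval (P.incl : B →ₐ[ℂ] A) X (p k i) using 2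
    ext i j
    simp [distribution, Matrix.mul_apply, BPoly.eval_star P.incl hX]

end OpValuedCStarProbSpace

/-- A pointwise limit of `B`-valued distributions is a `B`-valued distribution. -/
theorem IsBDistribution.of_tendsto {B ι : Type*} [CStarAlgebra B] [PartialOrder B]
    [StarOrderedRing B] {l : Filter ι} [l.NeBot] {μ : ι → BPoly B →ₗ[ℂ] B} {ν : BPoly B →ₗ[ℂ] B}
    (hμ : ∀ i, IsBDistribution (μ i)) (h : ∀ p, Filter.Tendsto (fun i => μ i p) l (nhds (ν p))) :
    IsBDistribution ν where
  map_one := tendsto_nhds_unique (h 1) (by simp [(hμ _).map_one])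
  bimodule b p b' := by
    refine tendsto_nhds_unique (h _) ?_
    simp only [(hμ _).bimodule]
    exact ((h p).const_mul b).mul_const b'
  completelyPositive n p := by
    have h1 : Filter.Tendsto
        (fun i => CStarMatrix.ofMatrix ((p.conjTranspose * p).map (μ i))) l
        (nhds (CStarMatrix.ofMatrix ((p.conjTranspose * p).map ν))) :=
      tendsto_pi_nhds.mpr fun i => tendsto_pi_nhds.mpr fun j => h _
    -- Entrywise convergence is convergence in `CStarMatrix`, where the positive cone is closed.
    exact CStarAlgebra.isClosed_nonneg.mem_of_tendsto h1
      (Filter.Eventually.of_forall fun i => (hμ i).completelyPositive n p)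

/-! ### Alternating centred products -/

section Alternating

variable {R B : Type*} [Ring R] [Algebra ℂ R] [Ring B] [Algebra ℂ B]

/-- `w` is a product `p₁(Y i₁) ⋯ pₙ(Y iₙ)`, `n ≥ 1`, with `i₁ = i`, indices in `J`, different
neighbouring indices, and polynomials `p_j` which are centred with respect to `μ`. -/
inductive AlternatingProd (γ : B →ₐ[ℂ] R) (Y : ℕ → R) (μ : BPoly B →ₗ[ℂ] B) (J : Set ℕ) :
    ℕ → R → Prop
  | single {i : ℕ} {p : BPoly B} (hi : i ∈ J) (hp : μ p = 0) :
      AlternatingProd γ Y μ J i (BPoly.eval γ (Y i) p)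
  | cons {i j : ℕ} {p : BPoly B} {w : R} (hi : i ∈ J) (hp : μ p = 0) (hij : i ≠ j)
      (hw : AlternatingProd γ Y μ J j w) :
      AlternatingProd γ Y μ J i (BPoly.eval γ (Y i) p * w)

/-- The linear span of the alternating centred products. -/
def centredSpan (γ : B →ₐ[ℂ] R) (Y : ℕ → R) (μ : BPoly B →ₗ[ℂ] B) (J : Set ℕ) :
    Submodule ℂ R :=
  Submodule.span ℂ {w | ∃ i, AlternatingProd γ Y μ J i w}

/-- The span of the coefficients and the alternating centred products. -/
def alternatingSpan (γ : B →ₐ[ℂ] R) (Y : ℕ → R) (μ : BPoly B →ₗ[ℂ] B) (J : Set ℕ) :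
    Submodule ℂ R :=
  LinearMap.range γ.toLinearMap ⊔ centredSpan γ Y μ J

variable {γ : B →ₐ[ℂ] R} {Y : ℕ → R} {μ : BPoly B →ₗ[ℂ] B} {J : Set ℕ}

theorem AlternatingProd.const_mul (hμ : ∀ b p, μ (BPoly.C b * p) = b * μ p) (b : B) {i : ℕ}
    {w : R} (hw : AlternatingProd γ Y μ J i w) : AlternatingProd γ Y μ J i (γ b * w) := by
  cases hw with
  | @single _ p hi hp =>
    have := AlternatingProd.single (γ := γ) (Y := Y) (p := BPoly.C b * p) hi
      (by rw [hμ, hp, mul_zero])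
    rwa [map_mul, BPoly.eval_C] at this
  | @cons _ j p w hi hp hij hw =>
    have := AlternatingProd.cons (γ := γ) (Y := Y) (p := BPoly.C b * p) hi
      (by rw [hμ, hp, mul_zero]) hij hw
    rwa [map_mul, BPoly.eval_C, mul_assoc] at this

theorem AlternatingProd.mem_centredSpan {i : ℕ} {w : R} (hw : AlternatingProd γ Y μ J i w) :
    w ∈ centredSpan γ Y μ J := Submodule.subset_span ⟨i, hw⟩

theorem AlternatingProd.mem_alternatingSpan {i : ℕ} {w : R}
    (hw : AlternatingProd γ Y μ J i w) : w ∈ alternatingSpan γ Y μ J :=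
  Submodule.mem_sup_right hw.mem_centredSpan

theorem const_mem_alternatingSpan (b : B) : γ b ∈ alternatingSpan γ Y μ J :=
  Submodule.mem_sup_left ⟨b, rfl⟩

theorem eval_mem_alternatingSpan (hC : ∀ b, μ (BPoly.C b) = b) {i : ℕ} (hi : i ∈ J)
    (p : BPoly B) : BPoly.eval γ (Y i) p ∈ alternatingSpan γ Y μ J := by
  have h : BPoly.eval γ (Y i) p = BPoly.eval γ (Y i) (p - BPoly.C (μ p)) + γ (μ p) := by simp
  rw [h]
  exact add_mem (AlternatingProd.single hi (by simp [hC])).mem_alternatingSpan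
    (const_mem_alternatingSpan _)

theorem eval_mul_alternating_mem (hC : ∀ b, μ (BPoly.C b) = b)
    (hμ : ∀ b p, μ (BPoly.C b * p) = b * μ p) {i j : ℕ} (hi : i ∈ J) (hij : i ≠ j)
    (p : BPoly B) {w : R} (hw : AlternatingProd γ Y μ J j w) :
    BPoly.eval γ (Y i) p * w ∈ alternatingSpan γ Y μ J := by
  have h : BPoly.eval γ (Y i) p * w
      = BPoly.eval γ (Y i) (p - BPoly.C (μ p)) * w + γ (μ p) * w := by
    rw [← add_mul]; simp
  rw [h]
  exact add_mem (AlternatingProd.cons hi (by simp [hC]) hij hw).mem_alternatingSpan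
    (hw.const_mul hμ _).mem_alternatingSpan

/-- If the new factor has the index of the first factor, the two merge into one polynomial, which is
recentred; otherwise only the new factor is recentred. No freeness enters and `R` is an arbitrary
algebra, which allows `R = A × A` later. -/
theorem eval_mul_mem_alternatingSpan (hC : ∀ b, μ (BPoly.C b) = b)
    (hμ : ∀ b p, μ (BPoly.C b * p) = b * μ p) {i : ℕ} (hi : i ∈ J) (p : BPoly B) {w : R}
    (hw : w ∈ alternatingSpan γ Y μ J) :
    BPoly.eval γ (Y i) p * w ∈ alternatingSpan γ Y μ J := by
  obtain ⟨_, ⟨b, rfl⟩, v, hv, rfl⟩ := Submodule.mem_sup.mp hw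
  clear hw
  rw [mul_add]
  refine add_mem ?_ ?_
  · have := eval_mem_alternatingSpan (γ := γ) (Y := Y) hC hi (p * BPoly.C b)
    rwa [map_mul, BPoly.eval_C] at this
  · induction hv using Submodule.span_induction with
    | zero => rw [mul_zero]; exact zero_mem _
    | add u v _ _ hu hv =>
      rw [mul_add]
      exact add_mem hu hv
    | smul c v _ hv =>
      rw [mul_smul_comm]
      exact Submodule.smul_mem _ _ hv
    | mem v h =>
      obtain ⟨j, hv⟩ := h
      by_cases hij : i = j
      · subst hij
        cases hv with
        | single hi hp => rw [← map_mul]; exact eval_mem_alternatingSpan hC hi _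
        | cons hi hp hij hw =>
          rw [← mul_assoc, ← map_mul]
          exact eval_mul_alternating_mem hC hμ hi hij _ hw
      · exact eval_mul_alternating_mem hC hμ hi hij p hv

theorem AlternatingProd.map {R' : Type*} [Ring R'] [Algebra ℂ R'] (f : R →ₐ[ℂ] R') {i : ℕ} {w : R}
    (hw : AlternatingProd γ Y μ J i w) :
    AlternatingProd (f.comp γ) (fun j => f (Y j)) μ J i (f w) := by
  have key : ∀ i p, f (BPoly.eval γ (Y i) p) = BPoly.eval (f.comp γ) (f (Y i)) p := by
    intro i p
    induction p using BPoly.induction with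
    | const b => simp
    | var => simp
    | add p q hp hq => simp [hp, hq]
    | mul p q hp hq => simp [hp, hq]
  induction hw with
  | single hi hp => rw [key]; exact .single hi hp
  | cons hi hp hij _ ih => rw [map_mul, key]; exact .cons hi hp hij ih

theorem AlternatingProd.mono {J' : Set ℕ} (hJ : J ⊆ J') {i : ℕ} {w : R}
    (hw : AlternatingProd γ Y μ J i w) : AlternatingProd γ Y μ J' i w := by
  induction hw with
  | single hi hp => exact .single (hJ hi) hp
  | cons hi hp hij _ ih => exact .cons (hJ hi) hp hij ih

/-- All indices of `w` lie in `J` and `v` starts with `i ∉ J`, so the indices also differ at the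
junction. -/
theorem AlternatingProd.append {i j : ℕ} (hi : i ∉ J) {w v : R}
    (hw : AlternatingProd γ Y μ J j w) (hv : AlternatingProd γ Y μ Set.univ i v) :
    AlternatingProd γ Y μ Set.univ j (w * v) := by
  induction hw with
  | single hj hp => exact .cons trivial hp (by rintro rfl; exact hi hj) hv
  | cons hj hp hij _ ih => rw [mul_assoc]; exact .cons trivial hp hij ih

theorem AlternatingProd.index_mem {i : ℕ} {w : R} (hw : AlternatingProd γ Y μ J i w) : i ∈ J := by
  cases hw with
  | single h _ => exact h
  | cons h _ _ _ => exact h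

theorem eq_zero_of_mem_centredSpan {M : Type*} [AddCommGroup M] [Module ℂ M] (f : R →ₗ[ℂ] M)
    (hf : ∀ i w, AlternatingProd γ Y μ J i w → f w = 0) {v : R}
    (hv : v ∈ centredSpan γ Y μ J) : f v = 0 := by
  have h : centredSpan γ Y μ J ≤ LinearMap.ker f :=
    Submodule.span_le.mpr fun w ⟨i, hw⟩ => hf i w hw
  exact h hv

end Alternating

/-- The word `b_lo y_lo b_{lo+1} ⋯ y_{lo+n-1} b_{lo+n}`. -/
def segmentWord {R : Type*} [Mul R] (b y : ℕ → R) : ℕ → ℕ → R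
  | lo, 0 => b lo
  | lo, n + 1 => b lo * y lo * segmentWord b y (lo + 1) n

theorem segmentWord_split {R : Type*} [Semigroup R] (b y : ℕ → R) (lo m n : ℕ) :
    segmentWord b y lo (m + n + 1)
      = segmentWord b y lo m * y (lo + m) * segmentWord b y (lo + m + 1) n := by
  induction m generalizing lo with
  | zero => rw [zero_add]; rfl
  | succ m ih =>
    rw [show m + 1 + n + 1 = (m + n + 1) + 1 by ring, segmentWord, ih, segmentWord]
    rw [show lo + 1 + m = lo + (m + 1) by ring]
    simp only [mul_assoc]

theorem segmentWord_congr {R : Type*} [Mul R] {b y y' : ℕ → R} {lo n : ℕ}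
    (h : ∀ p, lo ≤ p → p < lo + n → y p = y' p) :
    segmentWord b y lo n = segmentWord b y' lo n := by
  induction n generalizing lo with
  | zero => rfl
  | succ n ih =>
    rw [segmentWord, segmentWord, h lo le_rfl (by omega),
      ih fun p h1 h2 => h p (by omega) (by omega)]

theorem segmentWord_mem_alternatingSpan {R B : Type*} [Ring R] [Algebra ℂ R] [Ring B]
    [Algebra ℂ B] {γ : B →ₐ[ℂ] R} {Y : ℕ → R} {μ : BPoly B →ₗ[ℂ] B} {J : Set ℕ}
    (hC : ∀ b, μ (BPoly.C b) = b) (hμ : ∀ b p, μ (BPoly.C b * p) = b * μ p) (b : ℕ → B)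
    (idx : ℕ → ℕ) (lo n : ℕ) (hidx : ∀ p, lo ≤ p → p < lo + n → idx p ∈ J) :
    segmentWord (fun j => γ (b j)) (fun j => Y (idx j)) lo n ∈ alternatingSpan γ Y μ J := by
  induction n generalizing lo with
  | zero => exact const_mem_alternatingSpan _
  | succ n ih =>
    have := eval_mul_mem_alternatingSpan hC hμ (hidx lo le_rfl (by omega))
      (BPoly.C (b lo) * BPoly.x) (ih (lo + 1) fun p h1 h2 => hidx p (by omega) (by omega))
    rwa [map_mul, BPoly.eval_C, BPoly.eval_x] at this

theorem map_segmentWord {R R' F : Type*} [Mul R] [Mul R'] [FunLike F R R'] [MulHomClass F R R']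
    (f : F) (b y : ℕ → R) (lo n : ℕ) :
    f (segmentWord b y lo n) = segmentWord (fun j => f (b j)) (fun j => f (y j)) lo n := by
  induction n generalizing lo with
  | zero => rfl
  | succ n ih => simp only [segmentWord, map_mul, ih]

/-! ### Consequences of freeness -/

namespace OpValuedCStarProbSpace

variable {A B : Type*} [CStarAlgebra A] [CStarAlgebra B] {P : OpValuedCStarProbSpace A B}
  {X : ℕ → A} {μ : BPoly B →ₗ[ℂ] B} {J : Set ℕ}

theorem eval_mem_generated (P : OpValuedCStarProbSpace A B) (a : A) (p : BPoly B) :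
    BPoly.eval (P.incl : B →ₐ[ℂ] A) a p ∈ P.generated a := by
  induction p using BPoly.induction with
  | const b =>
    rw [BPoly.eval_C]
    exact Algebra.subset_adjoin (Or.inl ⟨b, rfl⟩)
  | var =>
    rw [BPoly.eval_x]
    exact Algebra.subset_adjoin (Or.inr rfl)
  | add p q hp hq => rw [map_add]; exact add_mem hp hq
  | mul p q hp hq => rw [map_mul]; exact mul_mem hp hq

/-- Unfolds the inductive predicate into the families over which freeness quantifies. The clause
`idx 0 = i` lets the induction compare a new factor with its neighbour. -/
theorem exists_factors_of_alternatingProd {σ : ℕ → ℕ}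
    (hid : ∀ i, P.distribution (X i) = μ) {i : ℕ} {w : A}
    (hw : AlternatingProd (P.incl : B →ₐ[ℂ] A) (fun j => X (σ j)) μ J i w) :
    ∃ (k : ℕ) (idx : Fin (k + 1) → ℕ) (a : Fin (k + 1) → A), idx 0 = i ∧ (∀ j, idx j ∈ J) ∧
      (∀ j, a j ∈ P.generated (X (σ (idx j)))) ∧ (∀ j, P.E (a j) = 0) ∧
      (∀ j : Fin k, idx j.castSucc ≠ idx j.succ) ∧ (List.ofFn a).prod = w := by
  induction hw with
  | @single i p hi hp =>
    refine ⟨0, fun _ => i, fun _ => BPoly.eval (P.incl : B →ₐ[ℂ] A) (X (σ i)) p, rfl, fun _ => hi,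
      fun _ => P.eval_mem_generated _ _, fun _ => ?_, fun j => j.elim0, by simp⟩
    rw [← hid (σ i)] at hp
    exact hp
  | @cons i j p w hi hp hij hw ih =>
    obtain ⟨k, idx, a, h0, hJ, hgen, hE, hne, hprod⟩ := ih
    refine ⟨k + 1, Fin.cons i idx,
      Fin.cons (BPoly.eval (P.incl : B →ₐ[ℂ] A) (X (σ i)) p) a, rfl, ?_, ?_, ?_, ?_, ?_⟩
    · intro j; cases j using Fin.cases with
      | zero => exact hi
      | succ j => exact hJ j
    · intro j; cases j using Fin.cases with
      | zero => exact P.eval_mem_generated _ _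
      | succ j => exact hgen j
    · intro j; cases j using Fin.cases with
      | zero => rw [← hid (σ i)] at hp; exact hp
      | succ j => exact hE j
    · intro j; cases j using Fin.cases with
      | zero => simpa [h0] using hij
      | succ j => simpa [← Fin.succ_castSucc] using hne j
    · rw [List.ofFn_succ, List.prod_cons]
      rw [← hprod]
      simp

/-- Relabelling the variables by `σ` keeps neighbouring indices different because `σ` is injective
on `J`, and keeps the factors centred because the distributions coincide. -/
theorem IsFree.E_alternatingProd (hfree : P.IsFree X) (hid : ∀ i, P.distribution (X i) = μ)
    {σ : ℕ → ℕ} (hσ : Set.InjOn σ J) {i : ℕ} {w : A}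
    (hw : AlternatingProd (P.incl : B →ₐ[ℂ] A) (fun j => X (σ j)) μ J i w) : P.E w = 0 := by
  obtain ⟨k, idx, a, -, hJ, hgen, hE, hne, rfl⟩ := exists_factors_of_alternatingProd hid hw
  exact hfree.2 k (fun j => σ (idx j)) a hgen hE fun j h => hne j (hσ (hJ _) (hJ _) h)

theorem distribution_C (hid : ∀ i, P.distribution (X i) = μ) (b : B) : μ (BPoly.C b) = b := by
  rw [← hid 0]
  simp [distribution, P.E_incl]

theorem distribution_C_mul (hid : ∀ i, P.distribution (X i) = μ) (b : B) (p : BPoly B) :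
    μ (BPoly.C b * p) = b * μ p := by
  rw [← hid 0]
  simp [distribution, P.E_incl_mul]

theorem distribution_x_mul_C (hid : ∀ i, P.distribution (X i) = μ)
    (hcentred : ∀ i, P.E (X i) = 0) (b : B) : μ (BPoly.x * BPoly.C b) = 0 := by
  rw [← hid 0]
  simp [distribution, P.E_mul_incl, hcentred]

theorem distribution_x (hid : ∀ i, P.distribution (X i) = μ)
    (hcentred : ∀ i, P.E (X i) = 0) : μ BPoly.x = 0 := by
  rw [← hid 0]
  simp [distribution, hcentred]

/-- The joint moments of free, identically distributed variables depend only on which of the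
indices coincide. -/
theorem IsFree.E_segmentWord_eq (hfree : P.IsFree X) (hid : ∀ i, P.distribution (X i) = μ)
    (b : ℕ → B) (idx idx' : ℕ → ℕ) (lo n : ℕ)
    (hker : ∀ p ∈ Set.Ico lo (lo + n), ∀ q ∈ Set.Ico lo (lo + n),
      idx p = idx q ↔ idx' p = idx' q) :
    P.E (segmentWord (fun j => P.incl (b j)) (fun j => X (idx j)) lo n)
      = P.E (segmentWord (fun j => P.incl (b j)) (fun j => X (idx' j)) lo n) := by
  classical
  let J : Set ℕ := idx '' Set.Ico lo (lo + n)
  -- The relabelling carrying `idx` to `idx'`; the value `0` is taken only outside `J`.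
  let σ : ℕ → ℕ := fun m =>
    if h : ∃ p ∈ Set.Ico lo (lo + n), idx p = m then idx' h.choose else 0
  have hσ : ∀ p ∈ Set.Ico lo (lo + n), σ (idx p) = idx' p := by
    intro p hp
    have h : ∃ q ∈ Set.Ico lo (lo + n), idx q = idx p := ⟨p, hp, rfl⟩
    have h1 : σ (idx p) = idx' h.choose := dif_pos h
    rw [h1]
    exact (hker _ h.choose_spec.1 _ hp).mp h.choose_spec.2
  have hinj : Set.InjOn σ J := by
    rintro _ ⟨p, hp, rfl⟩ _ ⟨q, hq, rfl⟩ h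
    rw [hσ p hp, hσ q hq] at h
    exact (hker p hp q hq).mpr h
  -- Both words are the projections of a single word in `A × A`. Its decomposition has the same
  -- coefficient part in both components, and the alternating parts have expectation zero in each.
  let γ : B →ₐ[ℂ] A × A := AlgHom.prod (P.incl : B →ₐ[ℂ] A) (P.incl : B →ₐ[ℂ] A)
  let Y : ℕ → A × A := fun j => (X j, X (σ j))
  have hmem := segmentWord_mem_alternatingSpan (γ := γ) (Y := Y) (J := J) (distribution_C hid)
    (distribution_C_mul hid) b idx lo n fun p h1 h2 => ⟨p, ⟨h1, h2⟩, rfl⟩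
  have hE : ∀ w ∈ alternatingSpan γ Y μ J, P.E w.1 = P.E w.2 := by
    intro w hw
    have hle : alternatingSpan γ Y μ J ≤ LinearMap.ker
        (P.E ∘ₗ LinearMap.fst ℂ A A - P.E ∘ₗ LinearMap.snd ℂ A A) := by
      refine sup_le ?_ (Submodule.span_le.mpr ?_)
      · rintro _ ⟨c, rfl⟩
        simp [γ]
      · rintro v ⟨i, hv⟩
        have h1 := hfree.E_alternatingProd (σ := id) hid (Set.injOn_id _)
          (hv.map (AlgHom.fst ℂ A A))
        have h2 := hfree.E_alternatingProd hid hinj (hv.map (AlgHom.snd ℂ A A))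
        change P.E v.1 - P.E v.2 = 0
        change P.E v.1 = 0 at h1
        change P.E v.2 = 0 at h2
        rw [h1, h2, sub_zero]
    exact sub_eq_zero.mp (hle hw)
  have h := hE _ hmem
  have h1 := map_segmentWord (AlgHom.fst ℂ A A) (fun j => γ (b j)) (fun j => Y (idx j)) lo n
  have h2 := map_segmentWord (AlgHom.snd ℂ A A) (fun j => γ (b j)) (fun j => Y (idx j)) lo n
  rw [AlgHom.fst_apply] at h1
  rw [AlgHom.snd_apply] at h2
  rw [h1, h2] at h
  refine h.trans (congrArg P.E (segmentWord_congr fun p h1 h2 => ?_))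
  exact congrArg X (hσ p ⟨h1, h2⟩)

theorem IsFree.E_centredSpan (hfree : P.IsFree X) (hid : ∀ i, P.distribution (X i) = μ) {v : A}
    (hv : v ∈ centredSpan (P.incl : B →ₐ[ℂ] A) X μ J) : P.E v = 0 :=
  eq_zero_of_mem_centredSpan P.E
    (fun _ _ hw => hfree.E_alternatingProd (σ := id) hid (Set.injOn_id _) hw) hv

theorem IsFree.exists_centred (hfree : P.IsFree X) (hid : ∀ i, P.distribution (X i) = μ) {w : A}
    (hw : w ∈ alternatingSpan (P.incl : B →ₐ[ℂ] A) X μ J) :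
    ∃ v ∈ centredSpan (P.incl : B →ₐ[ℂ] A) X μ J, w = P.incl (P.E w) + v := by
  obtain ⟨_, ⟨b, rfl⟩, v, hv, rfl⟩ := Submodule.mem_sup.mp hw
  refine ⟨v, hv, ?_⟩
  rw [map_add, hfree.E_centredSpan hid hv]
  simp [P.E_incl]

theorem IsFree.E_centred_mul_alternating (hfree : P.IsFree X)
    (hid : ∀ i, P.distribution (X i) = μ) {i : ℕ} (hi : i ∉ J) {v t : A}
    (hv : v ∈ centredSpan (P.incl : B →ₐ[ℂ] A) X μ J)
    (ht : AlternatingProd (P.incl : B →ₐ[ℂ] A) X μ Set.univ i t) : P.E (v * t) = 0 :=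
  eq_zero_of_mem_centredSpan (P.E ∘ₗ LinearMap.mulRight ℂ t) (fun _ _ hw =>
    hfree.E_alternatingProd (σ := id) hid (Set.injOn_id _) (hw.append hi ht)) hv

/-- The factor `q` need not be centred: its mean is a coefficient that leaves `E` by bimodularity,
multiplying `E[w] = 0`. -/
theorem IsFree.E_eval_mul_alternating (hfree : P.IsFree X) (hid : ∀ i, P.distribution (X i) = μ)
    {i j : ℕ} (hij : i ≠ j) (q : BPoly B) {w : A}
    (hw : AlternatingProd (P.incl : B →ₐ[ℂ] A) X μ Set.univ j w) :
    P.E (BPoly.eval (P.incl : B →ₐ[ℂ] A) (X i) q * w) = 0 := by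
  have h1 := AlternatingProd.cons (γ := (P.incl : B →ₐ[ℂ] A)) (Y := X) (J := Set.univ)
    (p := q - BPoly.C (μ q)) (Set.mem_univ i) (by simp [distribution_C hid]) hij hw
  have h2 := hfree.E_alternatingProd (σ := id) hid (Set.injOn_id _) h1
  have h3 : P.E w = 0 := hfree.E_alternatingProd (σ := id) hid (Set.injOn_id _) hw
  rw [map_sub, sub_mul, map_sub, BPoly.eval_C] at h2
  change _ - P.E (P.incl (μ q) * w) = 0 at h2
  rwa [P.E_incl_mul, h3, mul_zero, sub_zero] at h2

theorem IsFree.E_eval_mul_centred (hfree : P.IsFree X) (hid : ∀ i, P.distribution (X i) = μ)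
    {i : ℕ} (hi : i ∉ J) (q : BPoly B) {v : A}
    (hv : v ∈ centredSpan (P.incl : B →ₐ[ℂ] A) X μ J) :
    P.E (BPoly.eval (P.incl : B →ₐ[ℂ] A) (X i) q * v) = 0 := by
  refine eq_zero_of_mem_centredSpan
    (P.E ∘ₗ LinearMap.mulLeft ℂ (BPoly.eval (P.incl : B →ₐ[ℂ] A) (X i) q)) (fun j w hw => ?_) hv
  refine hfree.E_eval_mul_alternating hid ?_ q (hw.mono (Set.subset_univ _))
  rintro rfl
  cases hw with
  | single h _ => exact hi h
  | cons h _ _ _ => exact hi h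

theorem alternatingProd_X_mul (hid : ∀ i, P.distribution (X i) = μ)
    (hcentred : ∀ i, P.E (X i) = 0) {i j : ℕ} (hij : i ≠ j) {w : A}
    (hw : AlternatingProd (P.incl : B →ₐ[ℂ] A) X μ Set.univ j w) :
    AlternatingProd (P.incl : B →ₐ[ℂ] A) X μ Set.univ i (X i * w) := by
  have := AlternatingProd.cons (γ := (P.incl : B →ₐ[ℂ] A)) (Y := X)
    (Set.mem_univ i) (distribution_x hid hcentred) hij hw
  rwa [BPoly.eval_x] at this

theorem alternatingProd_X_mul_incl (hid : ∀ i, P.distribution (X i) = μ)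
    (hcentred : ∀ i, P.E (X i) = 0) (i : ℕ) (b : B) :
    AlternatingProd (P.incl : B →ₐ[ℂ] A) X μ Set.univ i (X i * P.incl b) := by
  have := AlternatingProd.single (γ := (P.incl : B →ₐ[ℂ] A)) (Y := X)
    (Set.mem_univ i) (distribution_x_mul_C hid hcentred b)
  rwa [map_mul, BPoly.eval_x, BPoly.eval_C] at this

/-- A word in which one index occurs exactly once has expectation zero. -/
theorem IsFree.E_mul_X_mul (hfree : P.IsFree X) (hid : ∀ i, P.distribution (X i) = μ)
    (hcentred : ∀ i, P.E (X i) = 0) {i : ℕ} (hi : i ∉ J) {v w : A}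
    (hv : v ∈ alternatingSpan (P.incl : B →ₐ[ℂ] A) X μ J)
    (hw : w ∈ alternatingSpan (P.incl : B →ₐ[ℂ] A) X μ J) :
    P.E (v * (X i * w)) = 0 := by
  obtain ⟨v', hv', hve⟩ := hfree.exists_centred hid hv
  obtain ⟨w', hw', hwe⟩ := hfree.exists_centred hid hw
  rw [hve, hwe]
  -- With `v` and `w` split into mean and centred part there are four terms: the one with both means
  -- contains `E[X i] = 0`, and the others are covered by freeness since `i ∉ J`.
  simp only [add_mul, mul_add, map_add, P.E_incl_mul, P.E_mul_incl, hcentred]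
  rw [hfree.E_centred_mul_alternating hid hi hv' (alternatingProd_X_mul_incl hid hcentred i _)]
  have h1 := hfree.E_eval_mul_centred hid hi BPoly.x hw'
  rw [BPoly.eval_x] at h1
  have h2 : P.E (v' * (X i * w')) = 0 := by
    refine eq_zero_of_mem_centredSpan
      (P.E ∘ₗ LinearMap.mulLeft ℂ v' ∘ₗ LinearMap.mulLeft ℂ (X i)) (fun j u hu => ?_) hw'
    refine hfree.E_centred_mul_alternating hid hi hv' (alternatingProd_X_mul hid hcentred ?_
      (hu.mono (Set.subset_univ _)))
    rintro rfl
    exact hi (AlternatingProd.index_mem hu)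
  rw [h1, h2]
  simp

/-- Evaluation of a pair of variables with an index which occurs nowhere else in the word. -/
theorem IsFree.E_X_mul_X_mul (hfree : P.IsFree X) (hid : ∀ i, P.distribution (X i) = μ)
    (hcentred : ∀ i, P.E (X i) = 0) {i : ℕ} (hi : i ∉ J) {v w : A}
    (hv : v ∈ alternatingSpan (P.incl : B →ₐ[ℂ] A) X μ J)
    (hw : w ∈ alternatingSpan (P.incl : B →ₐ[ℂ] A) X μ J) :
    P.E (X i * v * (X i * w)) = P.E (X i * P.incl (P.E v) * X i) * P.E w := by
  obtain ⟨v', hv', hve⟩ := hfree.exists_centred hid hv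
  obtain ⟨w', hw', hwe⟩ := hfree.exists_centred hid hw
  have hne : ∀ {j u}, AlternatingProd (P.incl : B →ₐ[ℂ] A) X μ J j u → i ≠ j := by
    rintro j u hu rfl
    exact hi (AlternatingProd.index_mem hu)
  have h1 : ∀ t, AlternatingProd (P.incl : B →ₐ[ℂ] A) X μ Set.univ i t →
      P.E (X i * v' * t) = 0 := by
    intro t ht
    refine eq_zero_of_mem_centredSpan
      (P.E ∘ₗ LinearMap.mulRight ℂ t ∘ₗ LinearMap.mulLeft ℂ (X i)) (fun j u hu => ?_) hv'
    have h := alternatingProd_X_mul hid hcentred (hne hu) (hu.append hi ht)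
    rw [← mul_assoc] at h
    exact hfree.E_alternatingProd (σ := id) hid (Set.injOn_id _) h
  have h2 : P.E (X i * v' * (X i * w')) = 0 :=
    eq_zero_of_mem_centredSpan
      (P.E ∘ₗ LinearMap.mulLeft ℂ (X i * v') ∘ₗ LinearMap.mulLeft ℂ (X i)) (fun j u hu =>
        h1 _ (alternatingProd_X_mul hid hcentred (hne hu) (hu.mono (Set.subset_univ _)))) hw'
  have h3 := hfree.E_eval_mul_centred hid hi
    (BPoly.x * BPoly.C (P.E v) * BPoly.x) hw'
  simp only [map_mul, BPoly.eval_x, BPoly.eval_C] at h3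
  change P.E (X i * P.incl (P.E v) * X i * w') = 0 at h3
  -- Only the first term survives. In the second, `X i E[v] X i` is a polynomial in `X i` followed
  -- by a centred word avoiding `i`; the last two are combinations of alternating products.
  have h4 : X i * v * (X i * w) = X i * P.incl (P.E v) * X i * P.incl (P.E w)
      + X i * P.incl (P.E v) * X i * w' + X i * v' * (X i * P.incl (P.E w))
      + X i * v' * (X i * w') := by
    conv_lhs => rw [hve, hwe]
    noncomm_ring
  rw [h4, map_add, map_add, map_add, h2, h3, h1 _ (alternatingProd_X_mul_incl hid hcentred i _),
    P.E_mul_incl]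
  simp only [add_zero]

end OpValuedCStarProbSpace

/-! ### Moments of words indexed by pairings -/

theorem nestedEval_self {B : Type*} [Mul B] (η : B → B) (s : ℕ → ℕ) (b : ℕ → B) (lo : ℕ) :
    nestedEval η s b lo lo = b lo := by
  rw [nestedEval, dif_neg (by omega)]

theorem nestedEval_of_lt {B : Type*} [Mul B] (η : B → B) (s : ℕ → ℕ) (b : ℕ → B) {lo hi : ℕ}
    (h : lo < s lo ∧ s lo < hi) : nestedEval η s b lo hi
      = b lo * η (nestedEval η s b (lo + 1) (s lo)) * nestedEval η s b (s lo + 1) hi := by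
  rw [nestedEval, dif_pos h]

/-- The segment `[lo, hi)` is a union of blocks of the pairing `s`. -/
def PairingClosed (s : ℕ → ℕ) (lo hi : ℕ) : Prop :=
  ∀ p, lo ≤ p → p < hi → lo ≤ s p ∧ s p < hi

/-- The pairing `s` has no crossing in the segment `[lo, hi)`. -/
def NonCrossingOn (s : ℕ → ℕ) (lo hi : ℕ) : Prop :=
  ∀ i j, lo ≤ i → j < hi → ¬ (i < j ∧ j < s i ∧ s i < s j)

/-- `s` is an involution of `[0, k)` without fixed points. -/
structure IsPairing (s : ℕ → ℕ) (k : ℕ) : Prop where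
  lt : ∀ p < k, s p < k
  ne : ∀ p < k, s p ≠ p
  invol : ∀ p < k, s (s p) = p

namespace IsPairing

variable {s : ℕ → ℕ} {k lo hi : ℕ}

theorem partner_first (hs : IsPairing s k) (hk : hi ≤ k) (hlt : lo < hi)
    (hcl : PairingClosed s lo hi) : lo < s lo ∧ s lo < hi := by
  have h1 := hcl lo le_rfl hlt
  have h2 := hs.ne lo (by omega)
  omega

theorem closed_right (hs : IsPairing s k) (hk : hi ≤ k) (hlt : lo < hi)
    (hcl : PairingClosed s lo hi) (hin : PairingClosed s (lo + 1) (s lo)) :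
    PairingClosed s (s lo + 1) hi := by
  intro p h1 h2
  have h3 := hs.partner_first hk hlt hcl
  have h4 := hcl p (by omega) h2
  have h5 := hs.invol p (by omega)
  refine ⟨?_, h4.2⟩
  by_contra hcon
  rcases Nat.lt_trichotomy (s p) lo with h | h | h
  · omega
  · rw [h] at h5; omega
  · rcases Nat.lt_trichotomy (s p) (s lo) with h' | h' | h'
    · have := hin (s p) (by omega) h'
      omega
    · have h6 := hs.invol lo (by omega)
      rw [← h', h5] at h6
      omega
    · omega

/-- When the inside of the first block is a union of blocks, so is the part to its right, and no
crossing can involve the first block or both parts. -/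
theorem nonCrossingOn_iff (hs : IsPairing s k) (hk : hi ≤ k) (hlt : lo < hi)
    (hcl : PairingClosed s lo hi) (hin : PairingClosed s (lo + 1) (s lo)) :
    NonCrossingOn s lo hi ↔ NonCrossingOn s (lo + 1) (s lo) ∧ NonCrossingOn s (s lo + 1) hi := by
  have h3 := hs.partner_first hk hlt hcl
  constructor
  · intro h
    exact ⟨fun i j h1 h2 => h i j (by omega) (by omega),
      fun i j h1 h2 => h i j (by omega) (by omega)⟩
  · rintro ⟨hA, hB⟩ i j h1 h2 ⟨h4, h5, h6⟩
    rcases Nat.lt_trichotomy i lo with h | h | h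
    · omega
    · subst h
      have := hin j (by omega) (by omega)
      omega
    · rcases Nat.lt_trichotomy i (s lo) with h' | h' | h'
      · have := hin i (by omega) h'
        exact hA i j (by omega) (by omega) ⟨h4, h5, h6⟩
      · have h7 := hs.invol lo (by omega)
        rw [h'] at h5
        omega
      · exact hB i j (by omega) h2 ⟨h4, h5, h6⟩

/-- A point inside the first block whose partner is not inside must be paired beyond `s lo`, since
`lo` and `s lo` are taken by each other. -/
theorem exists_crossing (hs : IsPairing s k) (hk : hi ≤ k) (hlt : lo < hi)
    (hcl : PairingClosed s lo hi) (hin : ¬ PairingClosed s (lo + 1) (s lo)) :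
    ∃ q, lo < q ∧ q < s lo ∧ s lo < s q := by
  have h3 := hs.partner_first hk hlt hcl
  simp only [PairingClosed, not_forall] at hin
  obtain ⟨q, h1, h2, h4⟩ := hin
  have h5 := hcl q (by omega) (by omega)
  have h6 := hs.invol q (by omega)
  have h7 := hs.invol lo (by omega)
  have h8 : s q ≠ lo := fun h => by rw [h] at h6; omega
  have h9 : s q ≠ s lo := fun h => by rw [h, h7] at h6; omega
  exact ⟨q, by omega, h2, by omega⟩

end IsPairing

namespace OpValuedCStarProbSpace

variable {A B : Type*} [CStarAlgebra A] [CStarAlgebra B] {P : OpValuedCStarProbSpace A B}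
  {X : ℕ → A} {μ : BPoly B →ₗ[ℂ] B}

theorem IsFree.E_segmentWord_eq_zero (hfree : P.IsFree X) (hid : ∀ i, P.distribution (X i) = μ)
    (hcentred : ∀ i, P.E (X i) = 0) (b : ℕ → B) (idx : ℕ → ℕ) {lo n q : ℕ} (h1 : lo ≤ q)
    (h2 : q < lo + n) (hq : ∀ p, lo ≤ p → p < lo + n → p ≠ q → idx p ≠ idx q) :
    P.E (segmentWord (fun j => P.incl (b j)) (fun j => X (idx j)) lo n) = 0 := by
  obtain ⟨m, rfl⟩ := Nat.exists_eq_add_of_le h1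
  obtain ⟨r, rfl⟩ : ∃ r, n = m + r + 1 := ⟨n - m - 1, by omega⟩
  rw [segmentWord_split, mul_assoc]
  refine hfree.E_mul_X_mul (J := {idx (lo + m)}ᶜ) hid hcentred (by simp) ?_ ?_
  · exact segmentWord_mem_alternatingSpan (distribution_C hid) (distribution_C_mul hid) b idx lo m
      fun p h3 h4 => hq p h3 (by omega) (by omega)
  · exact segmentWord_mem_alternatingSpan (distribution_C hid) (distribution_C_mul hid) b idx _ r
      fun p h3 h4 => hq p (by omega) (by omega) (by omega)

/-- Strong induction on the length, removing the block of the first letter, which mirrors the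
recursion of `nestedEval`. -/
theorem IsFree.E_segmentWord_pairing (hfree : P.IsFree X) (hid : ∀ i, P.distribution (X i) = μ)
    (hcentred : ∀ i, P.E (X i) = 0) {η : B → B} (hη : η 0 = 0)
    (hcov : ∀ i b, P.E (X i * P.incl b * X i) = η b)
    {s : ℕ → ℕ} {k : ℕ} (hs : IsPairing s k) (b : ℕ → B) (idx : ℕ → ℕ)
    (hidx : ∀ p < k, ∀ q < k, idx p = idx q ↔ p = q ∨ p = s q) (n lo : ℕ) (hk : lo + n ≤ k)
    (hcl : PairingClosed s lo (lo + n)) :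
    (NonCrossingOn s lo (lo + n) →
      P.E (segmentWord (fun j => P.incl (b j)) (fun j => X (idx j)) lo n)
        = nestedEval η s b lo (lo + n)) ∧
    (¬ NonCrossingOn s lo (lo + n) →
      P.E (segmentWord (fun j => P.incl (b j)) (fun j => X (idx j)) lo n) = 0) := by
  induction n using Nat.strong_induction_on generalizing lo with
  | h n ih =>
    rcases n with _ | m
    · constructor
      · intro _
        rw [add_zero, nestedEval_self]
        exact P.E_incl _
      · intro h
        exact absurd (fun i j h1 h2 => by omega) h
    · have hp := hs.partner_first hk (by omega) hcl
      set j := s lo with hj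
      obtain ⟨m₁, hm₁⟩ : ∃ m₁, j = lo + 1 + m₁ := ⟨j - lo - 1, by omega⟩
      obtain ⟨m₂, hm₂⟩ : ∃ m₂, m = m₁ + m₂ + 1 := ⟨m - m₁ - 1, by omega⟩
      have hhi : lo + (m + 1) = j + 1 + m₂ := by omega
      have hinv := hs.invol lo (by omega)
      rw [← hj] at hinv
      have hidxj : idx j = idx lo := (hidx j (by omega) lo (by omega)).mpr (Or.inr hj)
      have hmem : ∀ lo' n', lo ≤ lo' → lo' + n' ≤ k →
          (∀ p, lo' ≤ p → p < lo' + n' → p ≠ lo ∧ p ≠ j) →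
          segmentWord (fun j => P.incl (b j)) (fun j => X (idx j)) lo' n'
            ∈ alternatingSpan (P.incl : B →ₐ[ℂ] A) X μ {idx lo}ᶜ := by
        intro lo' n' h1 h2 h3
        refine segmentWord_mem_alternatingSpan (distribution_C hid) (distribution_C_mul hid) b idx
          lo' n' fun p h4 h5 h6 => ?_
        have h7 := h3 p h4 h5
        rcases (hidx p (by omega) lo (by omega)).mp h6 with h | h
        · exact h7.1 h
        · exact h7.2 h
      -- Valid with or without crossings: it only needs the index of the first letter to occur at
      -- `lo` and `j` alone.
      have hword : P.E (segmentWord (fun j => P.incl (b j)) (fun j => X (idx j)) lo (m + 1))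
          = b lo * η (P.E (segmentWord (fun j => P.incl (b j)) (fun j => X (idx j)) (lo + 1) m₁))
            * P.E (segmentWord (fun j => P.incl (b j)) (fun j => X (idx j)) (j + 1) m₂) := by
        rw [segmentWord, hm₂, segmentWord_split, ← hm₁, hidxj, mul_assoc, P.E_incl_mul,
          mul_assoc (segmentWord _ _ _ _), ← mul_assoc (X (idx lo)),
          hfree.E_X_mul_X_mul hid hcentred (J := {idx lo}ᶜ) (by simp)
            (hmem _ _ (by omega) (by omega) fun p h1 h2 => by omega)
            (hmem _ _ (by omega) (by omega) fun p h1 h2 => by omega), hcov, mul_assoc]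
      rw [hword, nestedEval_of_lt η s b hp, ← hj]
      by_cases hin : PairingClosed s (lo + 1) j
      · have hout := hs.closed_right hk (by omega) hcl hin
        have hnc := hs.nonCrossingOn_iff hk (by omega) hcl hin
        have ih₁ := ih m₁ (by omega) (lo + 1) (by omega) (by rwa [← hm₁])
        have ih₂ := ih m₂ (by omega) (j + 1) (by omega) (by rwa [← hhi])
        rw [← hm₁] at ih₁
        rw [← hhi] at ih₂
        rw [hnc]
        constructor
        · rintro ⟨hA, hB⟩
          rw [ih₁.1 hA, ih₂.1 hB]
        · intro h
          rcases not_and_or.mp h with hA | hB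
          · rw [ih₁.2 hA, hη, mul_zero, zero_mul]
          · rw [ih₂.2 hB, mul_zero]
      -- The partner of `q` lies beyond `j`, so the index of `q` occurs once in the enclosed word,
      -- whose expectation vanishes; then `η 0 = 0` finishes.
      · obtain ⟨q, h1, h2, h3⟩ := hs.exists_crossing hk (by omega) hcl hin
        constructor
        · intro h
          exact absurd ⟨h1, h2, h3⟩ (h lo q le_rfl (by omega))
        · intro _
          rw [hfree.E_segmentWord_eq_zero hid hcentred b idx (q := q) (by omega) (by omega)
            fun p h4 h5 h6 h7 => ?_, hη, mul_zero, zero_mul]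
          rcases (hidx p (by omega) q (by omega)).mp h7 with h | h
          · exact h6 h
          · omega

end OpValuedCStarProbSpace

/-! ### Pairings as functions on `ℕ`, and the outer coefficients of a word -/

theorem pairPartner_of_lt {k : ℕ} (σ : Equiv.Perm (Fin k)) {i : ℕ} (h : i < k) :
    pairPartner σ i = (σ ⟨i, h⟩ : ℕ) := dif_pos h

theorem pairPartner_coe {k : ℕ} (σ : Equiv.Perm (Fin k)) (i : Fin k) :
    pairPartner σ i = (σ i : ℕ) := dif_pos i.2

theorem isPairing_pairPartner {k : ℕ} {σ : Equiv.Perm (Fin k)} (hne : ∀ i, σ i ≠ i)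
    (hinv : ∀ i, σ (σ i) = i) : IsPairing (pairPartner σ) k where
  lt p hp := by rw [pairPartner_of_lt σ hp]; exact (σ _).2
  ne p hp := by
    rw [pairPartner_of_lt σ hp]
    exact fun h => hne ⟨p, hp⟩ (Fin.ext h)
  invol p hp := by rw [pairPartner_of_lt σ hp, pairPartner_coe, hinv]

theorem nonCrossingOn_pairPartner {k : ℕ} {σ : Equiv.Perm (Fin k)} (hne : ∀ i, σ i ≠ i)
    (hinv : ∀ i, σ (σ i) = i) : NonCrossingOn (pairPartner σ) 0 k ↔ σ ∈ NCPairings k := by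
  simp only [NCPairings, Finset.mem_filter, Finset.mem_univ, true_and]
  constructor
  · intro h
    refine ⟨hne, hinv, fun i j hij => h i j (Nat.zero_le _) j.2 ?_⟩
    rw [pairPartner_coe, pairPartner_coe]
    exact hij
  · rintro ⟨-, -, h⟩ i j - hj ⟨h1, h2, h3⟩
    rw [pairPartner_of_lt σ hj, pairPartner_of_lt σ (h1.trans hj)] at h3
    rw [pairPartner_of_lt σ (h1.trans hj)] at h2
    exact h ⟨i, h1.trans hj⟩ ⟨j, hj⟩ ⟨h1, h2, h3⟩

theorem segmentWord_mul_last {R : Type*} [Monoid R] {b b' : ℕ → R} (y : ℕ → R) {lo n : ℕ}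
    (h : ∀ p, lo ≤ p → p < lo + n → b p = b' p) (h' : b' (lo + n) = 1) :
    segmentWord b y lo n = segmentWord b' y lo n * b (lo + n) := by
  induction n generalizing lo with
  | zero => rw [add_zero] at h'; simp [segmentWord, h']
  | succ n ih =>
    rw [segmentWord, segmentWord, h lo le_rfl (by omega),
      ih (fun p h1 h2 => h p (by omega) (by omega)) (by rwa [add_right_comm]), mul_assoc _ _ (b _),
      add_right_comm, add_assoc]

/-- Splitting off the outer coefficients of a word. -/
theorem segmentWord_outer {R : Type*} [Monoid R] (b y : ℕ → R) {k : ℕ} (hk : 1 ≤ k) :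
    segmentWord b y 0 k
      = b 0 * segmentWord (fun j => if 0 < j ∧ j < k then b j else 1) y 0 k * b k := by
  obtain ⟨n, rfl⟩ : ∃ n, k = n + 1 := ⟨k - 1, by omega⟩
  rw [segmentWord, segmentWord, segmentWord_mul_last (lo := 0 + 1) (n := n) (b := b) y
    (b' := fun j => if 0 < j ∧ j < n + 1 then b j else 1)]
  · simp [mul_assoc, add_comm]
  · intro p h1 h2
    rw [if_pos (by omega)]
  · simp [add_comm]

theorem segmentWord_eq_prod {R : Type*} [Monoid R] (b y : ℕ → R) (lo n : ℕ) :
    segmentWord b y lo n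
      = b lo * ((List.range n).map fun j => y (lo + j) * b (lo + j + 1)).prod := by
  induction n generalizing lo with
  | zero => simp [segmentWord]
  | succ n ih =>
    rw [segmentWord, ih, List.range_succ_eq_map, List.map_cons, List.prod_cons, List.map_map]
    simp only [add_zero, mul_assoc]
    congr 4
    refine List.map_congr_left fun j _ => ?_
    simp only [Function.comp, Nat.succ_eq_add_one]
    rw [show lo + 1 + j = lo + (j + 1) by ring]

namespace OpValuedCStarProbSpace

variable {A B : Type*} [CStarAlgebra A] [CStarAlgebra B] {P : OpValuedCStarProbSpace A B}
  {X : ℕ → A} {μ : BPoly B →ₗ[ℂ] B}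

/-- The moment of a word whose coinciding indices are given by a pairing. -/
theorem IsFree.E_word_pairing (hfree : P.IsFree X)
    (hid : ∀ i, P.distribution (X i) = μ)
    (hcentred : ∀ i, P.E (X i) = 0) {η : B → B} (hη : η 0 = 0)
    (hcov : ∀ i b, P.E (X i * P.incl b * X i) = η b) {k : ℕ} (hk : 1 ≤ k)
    {σ : Equiv.Perm (Fin k)} (hne : ∀ i, σ i ≠ i) (hinv : ∀ i, σ (σ i) = i) (b : ℕ → B)
    (idx : ℕ → ℕ) (hidx : ∀ p q : Fin k, idx p = idx q ↔ p = q ∨ p = σ q) :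
    P.E (segmentWord (fun j => P.incl (b j)) (fun j => X (idx j)) 0 k)
      = if σ ∈ NCPairings k then b 0 * etaPairing η σ b * b k else 0 := by
  have hs := isPairing_pairPartner hne hinv
  have h := hfree.E_segmentWord_pairing hid hcentred hη hcov hs
    (fun j => if 0 < j ∧ j < k then b j else 1) idx
    (fun p hp q hq => by
      rw [hidx ⟨p, hp⟩ ⟨q, hq⟩, pairPartner_of_lt σ hq, Fin.ext_iff, Fin.ext_iff]) k 0 (by omega)
    (fun p _ hp => ⟨Nat.zero_le _, by rw [zero_add] at hp ⊢; exact hs.lt p hp⟩)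
  rw [zero_add, nonCrossingOn_pairPartner hne hinv] at h
  rw [segmentWord_outer _ _ hk, P.E_bimodule]
  have hb : (fun j => if 0 < j ∧ j < k then P.incl (b j) else 1)
      = fun j => P.incl (if 0 < j ∧ j < k then b j else 1) := by
    funext j
    split_ifs <;> simp
  rw [hb]
  split_ifs with hσ
  · rw [h.1 hσ, etaPairing]
  · rw [h.2 hσ, mul_zero, zero_mul]

end OpValuedCStarProbSpace

/-! ### Counting index functions -/

/-- The pairings of `{0, …, k - 1}`, as fixed-point-free involutions. -/
def allPairings (k : ℕ) : Finset (Equiv.Perm (Fin k)) :=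
  Finset.univ.filter fun σ => (∀ i, σ i ≠ i) ∧ ∀ i, σ (σ i) = i

theorem mem_allPairings {k : ℕ} {σ : Equiv.Perm (Fin k)} :
    σ ∈ allPairings k ↔ (∀ i, σ i ≠ i) ∧ ∀ i, σ (σ i) = i := by
  simp [allPairings]

/-- Two positions carry the same index exactly if they are equal or paired by `σ`. -/
def HasKernel {k : ℕ} {α : Type*} (i : Fin k → α) (σ : Equiv.Perm (Fin k)) : Prop :=
  ∀ p q, i p = i q ↔ p = q ∨ p = σ q

theorem HasKernel.unique {k : ℕ} {α : Type*} {i : Fin k → α} {σ τ : Equiv.Perm (Fin k)}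
    (hσ : σ ∈ allPairings k) (h : HasKernel i σ) (h' : HasKernel i τ) : σ = τ := by
  ext p
  have h1 := (h (σ p) p).mpr (Or.inr rfl)
  rcases (h' _ _).mp h1 with h2 | h2
  · exact absurd h2 ((mem_allPairings.mp hσ).1 p)
  · rw [h2]

/-- The fibres of `i` have at least two elements each and sizes summing to `k`. As `k` is at most
twice their number, each has exactly two, and `σ` swaps them. -/
theorem exists_hasKernel {k : ℕ} {α : Type*} [DecidableEq α] {i : Fin k → α}
    (h : ∀ p, ∃ q, q ≠ p ∧ i q = i p) (hk : k ≤ 2 * (Finset.univ.image i).card) :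
    ∃ σ ∈ allPairings k, HasKernel i σ := by
  choose q hq hiq using h
  have hpair : ∀ p, {p, q p} ⊆ Finset.univ.filter fun r => i r = i p := by
    intro p r hr
    rcases Finset.mem_insert.mp hr with rfl | hr
    · simp
    · rw [Finset.mem_singleton.mp hr]; simp [hiq]
  have hcard : ∀ p, ({p, q p} : Finset (Fin k)).card = 2 := fun p =>
    Finset.card_pair (hq p).symm
  have hge : ∀ v ∈ Finset.univ.image i, 2 ≤ (Finset.univ.filter fun r => i r = v).card := by
    intro v hv
    obtain ⟨p, -, rfl⟩ := Finset.mem_image.mp hv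
    rw [← hcard p]
    exact Finset.card_le_card (hpair p)
  have hsum := Finset.card_eq_sum_card_image i Finset.univ
  rw [Finset.card_univ, Fintype.card_fin] at hsum
  have hsum2 : ∑ v ∈ Finset.univ.image i, 2
      = ∑ v ∈ Finset.univ.image i, (Finset.univ.filter fun r => i r = v).card := by
    refine le_antisymm (Finset.sum_le_sum hge) ?_
    rw [← hsum, Finset.sum_const, smul_eq_mul, mul_comm]
    exact hk
  have heq := (Finset.sum_eq_sum_iff_of_le hge).mp hsum2
  have hfib : ∀ p r, i r = i p → r = p ∨ r = q p := by
    intro p r hr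
    have h1 : {p, q p} = Finset.univ.filter fun r => i r = i p :=
      Finset.eq_of_subset_of_card_le (hpair p)
        (by rw [hcard, ← heq (i p) (Finset.mem_image_of_mem i (Finset.mem_univ p))])
    have h2 : r ∈ ({p, q p} : Finset (Fin k)) := by rw [h1]; simp [hr]
    simpa using h2
  have hinv : Function.Involutive q := by
    intro p
    rcases hfib p (q (q p)) ((hiq _).trans (hiq p)) with h1 | h1
    · exact h1
    · exact absurd h1 (hq _)
  refine ⟨hinv.toPerm q, mem_allPairings.mpr ⟨hq, hinv⟩, fun p r => ?_⟩
  constructor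
  · exact hfib r p
  · rintro (rfl | rfl)
    · rfl
    · exact hiq r

theorem two_mul_card_openers {k : ℕ} {σ : Equiv.Perm (Fin k)} (hσ : σ ∈ allPairings k) :
    2 * Fintype.card {p // p < σ p} = k := by
  obtain ⟨hne, hinv⟩ := mem_allPairings.mp hσ
  have h1 : Fintype.card {p // p < σ p} = Fintype.card {p // ¬ p < σ p} := by
    refine Fintype.card_congr (Equiv.subtypeEquiv σ fun p => ?_)
    rw [hinv, not_lt]
    exact ⟨le_of_lt, fun h => lt_of_le_of_ne h (hne p).symm⟩
  have h2 := Fintype.card_subtype_compl fun p => p < σ p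
  have h3 := Fintype.card_subtype_le fun p => p < σ p
  rw [Fintype.card_fin] at h2 h3
  omega

/-- A function with kernel `σ` amounts to an injective choice of values on the left points of the
blocks. -/
theorem card_hasKernel {k N : ℕ} {σ : Equiv.Perm (Fin k)} (hσ : σ ∈ allPairings k)
    [DecidablePred fun i : Fin k → Fin N => HasKernel i σ] :
    (Finset.univ.filter fun i : Fin k → Fin N => HasKernel i σ).card
      = N.descFactorial (Fintype.card {p // p < σ p}) := by
  obtain ⟨hne, hinv⟩ := mem_allPairings.mp hσ
  have hlt : ∀ p, ¬ p < σ p → σ p < σ (σ p) := fun p h => by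
    rw [hinv]; exact lt_of_le_of_ne (not_lt.mp h) (hne p)
  rw [← Fintype.card_subtype]
  have e : {i : Fin k → Fin N // HasKernel i σ} ≃ ({p // p < σ p} ↪ Fin N) :=
    { toFun := fun i => ⟨fun p => i.1 p, fun p q h => by
        rcases (i.2 p q).mp h with h1 | h1
        · exact Subtype.ext h1
        · have hp := p.2
          have hq := q.2
          rw [h1, hinv] at hp
          exact absurd hp hq.asymm⟩
      invFun := fun g => ⟨fun p => if h : p < σ p then g ⟨p, h⟩ else g ⟨σ p, hlt p h⟩, by
        intro p q
        by_cases hp : p < σ p <;> by_cases hq : q < σ q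
        · simp only [hp, hq, dif_pos, g.injective.eq_iff, Subtype.mk.injEq]
          refine ⟨Or.inl, fun h => h.resolve_right fun h1 => ?_⟩
          rw [h1, hinv] at hp
          exact hp.asymm hq
        · simp only [hp, hq, dif_pos, dif_neg, not_false_eq_true, g.injective.eq_iff,
            Subtype.mk.injEq]
          refine ⟨Or.inr, fun h => h.resolve_left fun h1 => ?_⟩
          rw [h1] at hp
          exact hq hp
        · simp only [hp, hq, dif_pos, dif_neg, not_false_eq_true, g.injective.eq_iff,
            Subtype.mk.injEq]
          refine ⟨fun h => Or.inr (by rw [← h, hinv]), fun h => ?_⟩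
          rcases h with h | h
          · rw [h] at hp; exact absurd hq hp
          · rw [h, hinv]
        · simp only [hp, hq, dif_neg, not_false_eq_true, g.injective.eq_iff, Subtype.mk.injEq,
            σ.injective.eq_iff]
          refine ⟨Or.inl, fun h => h.resolve_right fun h1 => ?_⟩
          rw [h1, hinv] at hp
          exact hp (lt_of_le_of_ne (not_lt.mp hq) (hne q))⟩
      left_inv := fun i => by
        ext p
        by_cases hp : p < σ p
        · simp only [hp, dif_pos]
          rfl
        · simp only [hp, dif_neg, not_false_eq_true]
          exact congrArg Fin.val ((i.2 _ _).mpr (Or.inr rfl))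
      right_inv := fun g => by
        ext p
        simp [p.2] }
  rw [Fintype.card_congr e, Fintype.card_embedding_eq, Fintype.card_fin]

/-- A function with at most `d` values factors as `Fin k → Fin d → Fin N`. The assumption `1 ≤ k`
supplies a default element of `Fin N` for the second map. -/
theorem card_filter_image_le {k N d : ℕ} (hk : 1 ≤ k) :
    (Finset.univ.filter fun i : Fin k → Fin N => (Finset.univ.image i).card ≤ d).card
      ≤ d ^ k * N ^ d := by
  have h1 : (Finset.univ.filter fun i : Fin k → Fin N => (Finset.univ.image i).card ≤ d) ⊆
      (Finset.univ : Finset ((Fin k → Fin d) × (Fin d → Fin N))).image fun x => x.2 ∘ x.1 := by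
    intro i hi
    have hd := (Finset.mem_filter.mp hi).2
    have hN : Nonempty (Fin N) := ⟨i ⟨0, hk⟩⟩
    obtain ⟨e⟩ : Nonempty ({v // v ∈ Finset.univ.image i} ↪ Fin d) := by
      apply Function.Embedding.nonempty_of_card_le
      rw [Fintype.card_coe, Fintype.card_fin]
      exact hd
    let f : Fin k → Fin d := fun p => e ⟨i p, Finset.mem_image_of_mem i (Finset.mem_univ p)⟩
    let g : Fin d → Fin N := Function.extend e Subtype.val fun _ => hN.some
    refine Finset.mem_image.mpr ⟨(f, g), Finset.mem_univ _, ?_⟩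
    funext p
    exact e.injective.extend_apply Subtype.val (fun _ => hN.some) ⟨i p, _⟩
  calc _ ≤ _ := Finset.card_le_card h1
    _ ≤ _ := Finset.card_image_le
    _ = d ^ k * N ^ d := by simp

/-! ### Asymptotics of the normalized sum over index functions -/

theorem tendsto_inv_sqrt_pow_mul_descFactorial {k m : ℕ} (hm : 2 * m = k) :
    Filter.Tendsto (fun N : ℕ => (√(N : ℝ))⁻¹ ^ k * (N.descFactorial m : ℝ)) Filter.atTop
      (nhds 1) := by
  have h1 := (isEquivalent_descFactorial m)
  rw [Asymptotics.isEquivalent_iff_tendsto_one] at h1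
  · refine h1.congr fun N => ?_
    rw [← hm, pow_mul, inv_pow, Real.sq_sqrt (Nat.cast_nonneg N), Pi.div_apply, inv_pow,
      div_eq_inv_mul]
  · filter_upwards [Filter.eventually_gt_atTop 0] with N hN
    positivity

theorem tendsto_inv_sqrt_pow_mul_pow {k d : ℕ} (hd : 2 * d < k) :
    Filter.Tendsto (fun N : ℕ => (√(N : ℝ))⁻¹ ^ k * (N : ℝ) ^ d) Filter.atTop (nhds 0) := by
  obtain ⟨r, rfl⟩ : ∃ r, k = 2 * d + (r + 1) := ⟨k - 2 * d - 1, by omega⟩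
  have h1 : Filter.Tendsto (fun N : ℕ => (√(N : ℝ))⁻¹) Filter.atTop (nhds 0) :=
    tendsto_inv_atTop_zero.comp (Real.tendsto_sqrt_atTop.comp tendsto_natCast_atTop_atTop)
  have h2 := h1.pow (r + 1)
  rw [zero_pow (Nat.succ_ne_zero r)] at h2
  refine h2.congr' ?_
  filter_upwards [Filter.eventually_gt_atTop 0] with N hN
  have hN' : (0 : ℝ) < N := Nat.cast_pos.mpr hN
  rw [pow_add _ (2 * d), pow_mul, inv_pow (√(N : ℝ)) 2, Real.sq_sqrt hN'.le, mul_comm, ← mul_assoc,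
    ← mul_pow, mul_inv_cancel₀ hN'.ne', one_pow, one_mul]

section

variable {V : Type*} [NormedAddCommGroup V] {k : ℕ}

/-- Replacing each index by a chosen position carrying it preserves the kernel, so `F` takes all its
values on the finitely many functions `Fin k → Fin k`. -/
theorem exists_norm_le_of_kernel_invariant {F : (Fin k → ℕ) → V}
    (hF : ∀ i i' : Fin k → ℕ, (∀ p q, i p = i q ↔ i' p = i' q) → F i = F i') :
    ∃ K : ℝ, 0 ≤ K ∧ ∀ i, ‖F i‖ ≤ K := by
  refine ⟨∑ g : Fin k → Fin k, ‖F fun p => g p‖, Finset.sum_nonneg fun _ _ => norm_nonneg _,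
    fun i => ?_⟩
  let g : Fin k → Fin k := fun p => Set.rangeSplitting i ⟨i p, p, rfl⟩
  have hg : ∀ p, i (g p) = i p := fun p => Set.apply_rangeSplitting i ⟨i p, p, rfl⟩
  rw [hF i (fun p => g p) fun p q => ?_]
  · exact Finset.single_le_sum (f := fun g : Fin k → Fin k => ‖F fun p => g p‖)
      (fun _ _ => norm_nonneg _) (Finset.mem_univ g)
  · constructor
    · intro h
      simp only [g, h]
    · intro h
      rw [← hg p, ← hg q, Fin.ext h]

/-- If `F` depends only on the kernel of the index function and vanishes if some index occurs
exactly once, then only the pairings contribute to the normalized sum in the limit. -/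
theorem tendsto_normalized_sum_pairings [NormedSpace ℂ V] (hk : 1 ≤ k) {F : (Fin k → ℕ) → V}
    (hF : ∀ i i' : Fin k → ℕ, (∀ p q, i p = i q ↔ i' p = i' q) → F i = F i')
    (hsingle : ∀ (i : Fin k → ℕ) (p : Fin k), (∀ q, q ≠ p → i q ≠ i p) → F i = 0)
    {v : Equiv.Perm (Fin k) → V}
    (hv : ∀ σ ∈ allPairings k, ∀ i : Fin k → ℕ, HasKernel i σ → F i = v σ) :
    Filter.Tendsto
      (fun N : ℕ => (((√(N : ℝ) : ℝ) : ℂ)⁻¹) ^ k • ∑ i : Fin k → Fin N, F fun p => i p)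
      Filter.atTop (nhds (∑ σ ∈ allPairings k, v σ)) := by
  classical
  obtain ⟨K, hK0, hK⟩ := exists_norm_le_of_kernel_invariant hF
  have hker : ∀ {N} {i : Fin k → Fin N} {σ}, HasKernel i σ →
      HasKernel (fun p => (i p : ℕ)) σ := fun h p q => by
    rw [Fin.val_inj]; exact h p q
  -- The contribution of the index functions whose kernel is not a pairing.
  let G : (N : ℕ) → (Fin k → Fin N) → V := fun N i =>
    if ∃ σ ∈ allPairings k, HasKernel i σ then 0 else F fun p => i p
  -- The largest integer with `2 d < k`. A function with more than `d` values and no index occurring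
  -- once has a pairing as kernel, so `G` lives on functions with at most `d` values.
  let d := (k - 1) / 2
  have hGnorm : ∀ N i, ‖G N i‖ ≤ if (Finset.univ.image i).card ≤ d then K else 0 := by
    intro N i
    by_cases h1 : ∃ σ ∈ allPairings k, HasKernel i σ
    · simp only [G, if_pos h1, norm_zero]
      split_ifs <;> simp [hK0]
    · simp only [G, if_neg h1]
      split_ifs with h2
      · exact hK _
      · by_cases h3 : ∀ p, ∃ q, q ≠ p ∧ i q = i p
        · exact absurd (exists_hasKernel h3 (by omega)) h1
        · push Not at h3
          obtain ⟨p, hp⟩ := h3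
          rw [hsingle _ p fun q hq h => hp q hq (Fin.ext h), norm_zero]
  have hsum : ∀ N, ∑ i : Fin k → Fin N, F (fun p => i p)
      = ∑ σ ∈ allPairings k, N.descFactorial (Fintype.card {p // p < σ p}) • v σ
        + ∑ i, G N i := by
    intro N
    have h1 : ∀ i : Fin k → Fin N, F (fun p => i p)
        = (∑ σ ∈ allPairings k, if HasKernel i σ then v σ else 0) + G N i := by
      intro i
      by_cases h : ∃ σ ∈ allPairings k, HasKernel i σ
      · simp only [G, if_pos h, add_zero]
        obtain ⟨σ, hσ, hi⟩ := h
        rw [Finset.sum_eq_single_of_mem σ hσ fun τ hτ hne =>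
          if_neg fun h' => hne (HasKernel.unique hτ h' hi), if_pos hi]
        exact hv σ hσ _ (hker hi)
      · simp only [G, if_neg h]
        rw [Finset.sum_eq_zero fun σ hσ => if_neg fun h' => h ⟨σ, hσ, h'⟩, zero_add]
    rw [Finset.sum_congr rfl fun i _ => h1 i, Finset.sum_add_distrib, Finset.sum_comm]
    congr 1
    refine Finset.sum_congr rfl fun σ hσ => ?_
    rw [← Finset.sum_filter, Finset.sum_const, card_hasKernel hσ]
  simp only [hsum, smul_add]
  rw [← add_zero (∑ σ ∈ allPairings k, v σ)]
  refine Filter.Tendsto.add ?_ ?_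
  · simp only [Finset.smul_sum]
    refine tendsto_finsetSum _ fun σ hσ => ?_
    have h1 := tendsto_inv_sqrt_pow_mul_descFactorial (two_mul_card_openers hσ)
    have h2 := (Complex.continuous_ofReal.tendsto 1).comp h1
    have h3 := h2.smul_const (v σ)
    rw [Complex.ofReal_one, one_smul] at h3
    refine h3.congr fun N => ?_
    rw [Function.comp_apply, ← Nat.cast_smul_eq_nsmul ℂ, smul_smul]
    simp
  · have h1 : Filter.Tendsto (fun N : ℕ => (d ^ k : ℝ) * K * ((√(N : ℝ))⁻¹ ^ k * (N : ℝ) ^ d))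
        Filter.atTop (nhds 0) := by
      simpa using (tendsto_inv_sqrt_pow_mul_pow (k := k) (d := d) (by omega)).const_mul
        ((d ^ k : ℝ) * K)
    refine squeeze_zero_norm (fun N => ?_) h1
    have h2 : ‖∑ i, G N i‖ ≤ (d ^ k * N ^ d : ℝ) * K := by
      calc ‖∑ i, G N i‖ ≤ ∑ i, ‖G N i‖ := norm_sum_le _ _
        _ ≤ ∑ i : Fin k → Fin N, if (Finset.univ.image i).card ≤ d then K else 0 :=
          Finset.sum_le_sum fun i _ => hGnorm N i
        _ = (Finset.univ.filter fun i : Fin k → Fin N =>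
            (Finset.univ.image i).card ≤ d).card * K := by
          rw [← Finset.sum_filter, Finset.sum_const, nsmul_eq_mul]
        _ ≤ (d ^ k * N ^ d : ℝ) * K := by
          gcongr
          exact_mod_cast card_filter_image_le hk
    have h3 : ‖(((√(N : ℝ) : ℝ) : ℂ)⁻¹) ^ k‖ = (√(N : ℝ))⁻¹ ^ k := by
      rw [norm_pow, norm_inv, Complex.norm_real, Real.norm_of_nonneg (Real.sqrt_nonneg _)]
    rw [norm_smul, h3]
    calc _ ≤ (√(N : ℝ))⁻¹ ^ k * ((d ^ k * N ^ d : ℝ) * K) := by gcongr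
      _ = _ := by ring

end

/-! ### Bounds for nested evaluations -/

/-- The induction follows the recursion of `nestedEval`: every block contributes one factor `K` and
every coefficient occurs once. -/
theorem norm_nestedEval_le {B : Type*} [NormedRing B] {η : B → B} {K : ℝ} (hK : 1 ≤ K)
    (hη : ∀ b, ‖η b‖ ≤ K * ‖b‖) {s : ℕ → ℕ} {k : ℕ} (hs : IsPairing s k) (b : ℕ → B)
    (n lo : ℕ) (hk : lo + n ≤ k) (hcl : PairingClosed s lo (lo + n))
    (hnc : NonCrossingOn s lo (lo + n)) :
    ‖nestedEval η s b lo (lo + n)‖ ≤ K ^ n * ∏ j ∈ Finset.Ico lo (lo + n + 1), ‖b j‖ := by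
  induction n using Nat.strong_induction_on generalizing lo with
  | h n ih =>
    rcases n with _ | m
    · simp [nestedEval_self]
    · have hp := hs.partner_first hk (by omega) hcl
      have hin : PairingClosed s (lo + 1) (s lo) := by
        by_contra hin
        obtain ⟨q, hq⟩ := hs.exists_crossing hk (by omega) hcl hin
        exact hnc lo q le_rfl (by omega) hq
      have hout := hs.closed_right hk (by omega) hcl hin
      obtain ⟨hA, hB⟩ := (hs.nonCrossingOn_iff hk (by omega) hcl hin).mp hnc
      rw [nestedEval_of_lt η s b hp]
      generalize s lo = j at *
      obtain ⟨m₁, rfl⟩ : ∃ m₁, j = lo + 1 + m₁ := ⟨j - lo - 1, by omega⟩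
      obtain ⟨m₂, rfl⟩ : ∃ m₂, m = m₁ + m₂ + 1 := ⟨m - m₁ - 1, by omega⟩
      have hhi : lo + (m₁ + m₂ + 1 + 1) = lo + 1 + m₁ + 1 + m₂ := by omega
      rw [hhi] at hout hB ⊢
      have ih₁ := ih m₁ (by omega) (lo + 1) (by omega) hin hA
      have ih₂ := ih m₂ (by omega) (lo + 1 + m₁ + 1) (by omega) hout hB
      rw [Finset.prod_eq_prod_Ico_succ_bot (by omega),
        ← Finset.prod_Ico_consecutive _ (show lo + 1 ≤ lo + 1 + m₁ + 1 by omega)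
          (show lo + 1 + m₁ + 1 ≤ lo + 1 + m₁ + 1 + m₂ + 1 by omega)]
      set p₁ := ∏ j ∈ Finset.Ico (lo + 1) (lo + 1 + m₁ + 1), ‖b j‖
      set p₂ := ∏ j ∈ Finset.Ico (lo + 1 + m₁ + 1) (lo + 1 + m₁ + 1 + m₂ + 1), ‖b j‖
      have hp₁ : 0 ≤ p₁ := Finset.prod_nonneg fun _ _ => norm_nonneg _
      have hp₂ : 0 ≤ p₂ := Finset.prod_nonneg fun _ _ => norm_nonneg _
      have hK0 : 0 ≤ K := by linarith
      calc _ ≤ ‖b lo‖ * (K * (K ^ m₁ * p₁)) * (K ^ m₂ * p₂) := by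
            refine (norm_mul_le _ _).trans (mul_le_mul ?_ ih₂ (norm_nonneg _) (by positivity))
            refine (norm_mul_le _ _).trans (mul_le_mul_of_nonneg_left ?_ (norm_nonneg _))
            exact (hη _).trans (mul_le_mul_of_nonneg_left ih₁ hK0)
        _ = K ^ (m₁ + m₂ + 1) * (‖b lo‖ * (p₁ * p₂)) := by ring
        -- A block costs one factor `K` but has two positions; `1 ≤ K` absorbs the surplus and
        -- avoids halving the exponent.
        _ ≤ K ^ (m₁ + m₂ + 1 + 1) * (‖b lo‖ * (p₁ * p₂)) := by
            exact mul_le_mul_of_nonneg_right (pow_le_pow_right₀ hK (by omega))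
              (mul_nonneg (norm_nonneg _) (mul_nonneg hp₁ hp₂))

/-! ### Counting non-crossing pairings -/

theorem mem_NCPairings {k : ℕ} {σ : Equiv.Perm (Fin k)} : σ ∈ NCPairings k ↔
    (∀ i, σ i ≠ i) ∧ (∀ i, σ (σ i) = i) ∧ ∀ i j, ¬ (i < j ∧ j < σ i ∧ σ i < σ j) := by
  simp [NCPairings]

theorem NCPairings_subset (k : ℕ) : NCPairings k ⊆ allPairings k := fun _ hσ =>
  mem_allPairings.mpr ⟨(mem_NCPairings.mp hσ).1, (mem_NCPairings.mp hσ).2.1⟩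

theorem NCPairings_eq_empty {k : ℕ} (hk : Odd k) : NCPairings k = ∅ := by
  refine Finset.eq_empty_of_forall_notMem fun σ hσ => ?_
  have := two_mul_card_openers (NCPairings_subset k hσ)
  obtain ⟨m, hm⟩ := hk
  omega

/-- A non-crossing pairing is determined by the set of the left points of its blocks. -/
theorem NCPairings_ext {k : ℕ} {σ τ : Equiv.Perm (Fin k)} (hσ : σ ∈ NCPairings k)
    (hτ : τ ∈ NCPairings k) (h : ∀ p, p < σ p ↔ p < τ p) : σ = τ := by
  obtain ⟨hσne, hσinv, hσnc⟩ := mem_NCPairings.mp hσ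
  obtain ⟨hτne, hτinv, hτnc⟩ := mem_NCPairings.mp hτ
  -- Suppose `σ i < τ i` while `σ` and `τ` agree on left points beyond `i`. Then `σ i` is a right
  -- point of `τ` too, and non-crossing puts its `τ`-partner strictly between `i` and `σ i`. There
  -- `σ` and `τ` agree, so `σ i` would have two partners under `σ`.
  have key : ∀ {σ τ : Equiv.Perm (Fin k)}, (∀ i, τ i ≠ i) → (∀ i, σ (σ i) = i) →
      (∀ i, τ (τ i) = i) → (∀ i j, ¬ (i < j ∧ j < τ i ∧ τ i < τ j)) →
      (∀ p, p < σ p ↔ p < τ p) → ∀ i, i < σ i →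
      (∀ l, i < l → l < σ l → σ l = τ l) → ¬ σ i < τ i := by
    intro σ τ hτne hσinv hτinv hτnc h i hi hmax hlt
    have h1 : ¬ σ i < τ (σ i) := fun hc => by
      have := (h _).mpr hc
      rw [hσinv] at this
      exact this.asymm hi
    have h2 : τ (σ i) < σ i := lt_of_le_of_ne (not_lt.mp h1) (hτne _)
    have h3 : i < τ (σ i) := by
      rcases lt_trichotomy i (τ (σ i)) with h3 | h3 | h3
      · exact h3
      · rw [h3, hτinv] at hlt
        exact absurd hlt (by rw [← h3]; exact lt_irrefl _)
      · exact absurd ⟨h3, by rw [hτinv]; exact hi, by rw [hτinv]; exact hlt⟩ (hτnc (τ (σ i)) i)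
    have h4 : τ (σ i) < σ (τ (σ i)) := (h _).mpr (by rw [hτinv]; exact h2)
    have h5 := hmax _ h3 h4
    rw [hτinv] at h5
    exact h3.ne' (σ.injective h5)
  -- Induction from the rightmost left point leftwards; `key` is applied in both directions.
  have hopen : ∀ m : ℕ, ∀ i : Fin k, k - i ≤ m → i < σ i → σ i = τ i := by
    intro m
    induction m with
    | zero => intro i hi _; have := i.2; omega
    | succ m ih =>
      intro i hi hlt
      have hmax : ∀ l, i < l → l < σ l → σ l = τ l := fun l hl h' =>
        ih l (by have : (i : ℕ) < l := hl; omega) h'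
      refine le_antisymm (not_lt.mp ?_) (not_lt.mp ?_)
      · exact key hσne hτinv hσinv hσnc (fun p => (h p).symm) i ((h i).mp hlt)
          fun l hl h' => (hmax l hl ((h l).mpr h')).symm
      · exact key hτne hσinv hτinv hτnc h i hlt hmax
  refine Equiv.ext fun p => ?_
  by_cases hp : p < σ p
  · exact hopen k p (Nat.sub_le _ _) hp
  · have h1 : σ p < σ (σ p) := by rw [hσinv]; exact lt_of_le_of_ne (not_lt.mp hp) (hσne p)
    have h2 := hopen k _ (Nat.sub_le _ _) h1
    rw [hσinv] at h2
    have h3 := congrArg τ h2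
    rw [hτinv] at h3
    exact h3.symm

/-- A pairing is encoded by its set of left points. Exponential growth is what the bound in `Σ_B⁰`
requires; the number of all pairings grows too fast. -/
theorem card_NCPairings_le (k : ℕ) : (NCPairings k).card ≤ 2 ^ k := by
  classical
  have h : (NCPairings k).card ≤ (Finset.univ : Finset (Fin k → Bool)).card := by
    refine Finset.card_le_card_of_injOn (fun σ p => decide (p < σ p)) (fun _ _ => by simp) ?_
    intro σ hσ τ hτ h
    refine NCPairings_ext hσ hτ fun p => ?_
    simpa using congrFun h p
  simpa using h

/-- The inequality `‖1‖ ≤ 1` controls the two outer coefficients and, unlike equality, also covers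
the zero algebra. -/
theorem norm_etaPairing_le {B : Type*} [NormedRing B] (h1 : ‖(1 : B)‖ ≤ 1) {η : B → B} {K : ℝ}
    (hK : 1 ≤ K) (hη : ∀ b, ‖η b‖ ≤ K * ‖b‖) {n : ℕ} {σ : Equiv.Perm (Fin (n + 1))}
    (hσ : σ ∈ NCPairings (n + 1)) (b : ℕ → B) :
    ‖etaPairing η σ b‖ ≤ K ^ (n + 1) * ∏ j ∈ Finset.range n, ‖b (j + 1)‖ := by
  obtain ⟨hne, hinv, -⟩ := mem_NCPairings.mp hσ
  have hs := isPairing_pairPartner hne hinv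
  have h := norm_nestedEval_le hK hη hs (fun j => if 0 < j ∧ j < n + 1 then b j else 1)
    (n + 1) 0 (by omega)
    (fun p _ hp => ⟨Nat.zero_le _, by rw [zero_add] at hp ⊢; exact hs.lt p hp⟩)
    (by rw [zero_add]; exact (nonCrossingOn_pairPartner hne hinv).mpr hσ)
  rw [zero_add, ← Finset.range_eq_Ico, Finset.prod_range_succ, Finset.prod_range_succ'] at h
  refine h.trans ?_
  have h2 : ∏ j ∈ Finset.range n, ‖if 0 < j + 1 ∧ j + 1 < n + 1 then b (j + 1) else (1 : B)‖
      = ∏ j ∈ Finset.range n, ‖b (j + 1)‖ := by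
    refine Finset.prod_congr rfl fun j hj => ?_
    rw [if_pos ⟨Nat.succ_pos _, Nat.succ_lt_succ (Finset.mem_range.mp hj)⟩]
  rw [h2, if_neg (by omega), if_neg (by omega)]
  have hP : 0 ≤ ∏ j ∈ Finset.range n, ‖b (j + 1)‖ := Finset.prod_nonneg fun _ _ => norm_nonneg _
  refine mul_le_mul_of_nonneg_left ?_ (by positivity)
  calc _ ≤ (∏ j ∈ Finset.range n, ‖b (j + 1)‖) * 1 * 1 := by gcongr
    _ = _ := by ring

/-! ### Monomials -/

namespace BPoly

variable {B : Type*} [Ring B] [Algebra ℂ B]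

theorem monomial_zero (b : ℕ → B) : monomial 0 b = C (b 0) := by simp [monomial]

theorem eval_monomial {A : Type*} [Ring A] [Algebra ℂ A] (f : B →ₐ[ℂ] A) (a : A) (k : ℕ)
    (b : ℕ → B) :
    eval f a (monomial k b) = segmentWord (fun j => f (b j)) (fun _ => a) 0 k := by
  rw [segmentWord_eq_prod, monomial, map_mul, eval_C, map_list_prod, List.map_map]
  simp [Function.comp_def]

/-- The span contains `1` and is stable under left multiplication by the generators: a constant is
absorbed in the first coefficient, and `x` shifts the coefficients behind a new leading `1`. -/
theorem span_monomial : Submodule.span ℂ {p : BPoly B | ∃ k b, p = monomial k b} = ⊤ := by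
  set V := Submodule.span ℂ {p : BPoly B | ∃ k b, p = monomial k b} with hV
  have hmul : ∀ p : BPoly B, ∀ q ∈ V, p * q ∈ V := by
    intro p
    induction p using BPoly.induction with
    | const c =>
      intro q hq
      have hle : V ≤ V.comap (LinearMap.mulLeft ℂ (C c)) := by
        refine Submodule.span_le.mpr ?_
        rintro _ ⟨k, b, rfl⟩
        refine Submodule.subset_span ⟨k, fun j => if j = 0 then c * b 0 else b j, ?_⟩
        simp [monomial, mul_assoc]
      exact hle hq
    | var =>
      intro q hq
      have hle : V ≤ V.comap (LinearMap.mulLeft ℂ x) := by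
        refine Submodule.span_le.mpr ?_
        rintro _ ⟨k, b, rfl⟩
        refine Submodule.subset_span ⟨k + 1, fun j => if j = 0 then 1 else b (j - 1), ?_⟩
        simp [monomial, List.range_succ_eq_map, mul_assoc, Function.comp_def]
      exact hle hq
    | add p q hp hq => intro r hr; rw [add_mul]; exact add_mem (hp r hr) (hq r hr)
    | mul p q hp hq => intro r hr; rw [mul_assoc]; exact hp _ (hq r hr)
  refine eq_top_iff.mpr fun p _ => ?_
  rw [← mul_one p]
  exact hmul p 1 (Submodule.subset_span ⟨0, fun _ => 1, by simp [monomial]⟩)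

theorem prod_x_mul_C_mul_x (n : ℕ) (b : ℕ → B) :
    ((List.range n).map fun j => x * C (b j)).prod * x
      = monomial (n + 1) fun j => if 0 < j ∧ j < n + 1 then b (j - 1) else 1 := by
  rw [monomial, List.range_succ, List.map_append, List.prod_append]
  have h : ((List.range n).map fun j =>
      x * C (if 0 < j + 1 ∧ j + 1 < n + 1 then b (j + 1 - 1) else 1))
      = (List.range n).map fun j => x * C (b j) := by
    refine List.map_congr_left fun j hj => ?_
    rw [if_pos ⟨Nat.succ_pos _, Nat.succ_lt_succ (List.mem_range.mp hj)⟩, Nat.add_sub_cancel]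
  rw [h]
  simp

end BPoly

theorem IsBDistribution.map_C {B : Type*} [CStarAlgebra B] [PartialOrder B] [StarOrderedRing B]
    {μ : BPoly B →ₗ[ℂ] B} (hμ : IsBDistribution μ) (b : B) : μ (BPoly.C b) = b := by
  simpa [hμ.map_one] using hμ.bimodule b 1 1

theorem IsSemicircularDistribution.unique {B : Type*} [CStarAlgebra B] [PartialOrder B]
    [StarOrderedRing B] {η : CompletelyPositiveMap B B} {ν ν' : BPoly B →ₗ[ℂ] B}
    (h : IsSemicircularDistribution η ν) (h' : IsSemicircularDistribution η ν') : ν = ν' := by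
  refine LinearMap.ext_on BPoly.span_monomial ?_
  rintro _ ⟨k, b, rfl⟩
  rcases Nat.eq_zero_or_pos k with rfl | hk
  · rw [BPoly.monomial_zero, h.map_C, h'.map_C]
  · rw [h.moments k b hk, h'.moments k b hk]

theorem CompletelyPositiveMap.exists_norm_apply_le {B : Type*} [CStarAlgebra B] [PartialOrder B]
    [StarOrderedRing B] (η : CompletelyPositiveMap B B) :
    ∃ K : ℝ, 1 ≤ K ∧ ∀ b, ‖η b‖ ≤ K * ‖b‖ := by
  obtain ⟨K, hK⟩ := PositiveLinearMap.exists_norm_apply_le (.ofClass η : B →ₚ[ℂ] B)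
  refine ⟨max K 1, le_max_right _ _, fun b => (hK b).trans ?_⟩
  gcongr
  exact le_max_left _ _

/-- A distribution with semicircular moments is exponentially bounded. -/
theorem IsBDistribution.isSemicircularDistribution {B : Type*} [CStarAlgebra B] [PartialOrder B]
    [StarOrderedRing B] {η : CompletelyPositiveMap B B} {ν : BPoly B →ₗ[ℂ] B}
    (hν : IsBDistribution ν) (hmom : ∀ (k : ℕ) (b : ℕ → B), 1 ≤ k →
      ν (BPoly.monomial k b) = ∑ π ∈ NCPairings k, b 0 * etaPairing η π b * b k) :
    IsSemicircularDistribution η ν where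
  toIsBDistribution := hν
  moments := hmom
  expBounded := by
    obtain ⟨K, hK, hη⟩ := η.exists_norm_apply_le
    -- The factor `2` pays for the number of pairings, the factor `K` for the applications of `η`.
    refine ⟨2 * K, by linarith, fun n b => ?_⟩
    have hP : 0 ≤ ∏ j ∈ Finset.range n, ‖b j‖ := Finset.prod_nonneg fun _ _ => norm_nonneg _
    have h1 : ‖(1 : B)‖ ≤ 1 := by
      rcases subsingleton_or_nontrivial B with h | h
      · rw [Subsingleton.elim (1 : B) 0, norm_zero]; exact zero_le_one
      · exact CStarRing.norm_one.le
    rw [BPoly.prod_x_mul_C_mul_x, hmom _ _ (by omega)]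
    calc _ ≤ ∑ π ∈ NCPairings (n + 1), K ^ (n + 1) * ∏ j ∈ Finset.range n, ‖b j‖ := by
          refine norm_sum_le_of_le _ fun π hπ => ?_
          rw [if_neg (by omega), if_neg (by omega), one_mul, mul_one]
          refine (norm_etaPairing_le h1 hK hη hπ _).trans (le_of_eq ?_)
          congr 1
          refine Finset.prod_congr rfl fun j hj => ?_
          rw [if_pos ⟨Nat.succ_pos _, Nat.succ_lt_succ (Finset.mem_range.mp hj)⟩,
            Nat.add_sub_cancel]
      _ = (NCPairings (n + 1)).card * (K ^ (n + 1) * ∏ j ∈ Finset.range n, ‖b j‖) := by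
          rw [Finset.sum_const, nsmul_eq_mul]
      _ ≤ 2 ^ (n + 1) * (K ^ (n + 1) * ∏ j ∈ Finset.range n, ‖b j‖) := by
          gcongr
          exact_mod_cast card_NCPairings_le (n + 1)
      _ = _ := by rw [mul_pow, mul_assoc]

/-! ### Convergence of the moments -/

/-- Extension of an index function by zero. -/
def extendIndex {k : ℕ} (i : Fin k → ℕ) (p : ℕ) : ℕ := if h : p < k then i ⟨p, h⟩ else 0

theorem extendIndex_coe {k : ℕ} (i : Fin k → ℕ) (p : Fin k) : extendIndex i p = i p :=
  dif_pos p.2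

theorem segmentWord_eq_ofFn {R : Type*} [Monoid R] (b y : ℕ → R) (k : ℕ) :
    segmentWord b y 0 k = b 0 * (List.ofFn fun j : Fin k => y j * b (j + 1)).prod := by
  rw [segmentWord_eq_prod]
  congr 2
  refine List.ext_getElem (by simp) fun j _ _ => ?_
  simp

/-- Multilinearity of the product in the `k` factors `y j * b (j + 1)`. -/
theorem segmentWord_smul_sum {A : Type*} [Ring A] [Algebra ℂ A] (b X : ℕ → A) (c : ℂ)
    (N k : ℕ) :
    segmentWord b (fun _ => c • ∑ i ∈ Finset.range N, X i) 0 k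
      = c ^ k • ∑ i : Fin k → Fin N,
        segmentWord b (fun p => X (extendIndex (fun q => (i q : ℕ)) p)) 0 k := by
  simp only [segmentWord_eq_ofFn, extendIndex_coe]
  rw [← Finset.mul_sum, ← mul_smul_comm]
  congr 1
  have h1 := (MultilinearMap.mkPiAlgebraFin ℂ k A).map_sum
    fun (j : Fin k) (m : Fin N) => X m * b (j + 1)
  have h2 := (MultilinearMap.mkPiAlgebraFin ℂ k A).map_smul_univ (fun _ => c)
    fun j : Fin k => ∑ m : Fin N, X m * b (j + 1)
  simp only [MultilinearMap.mkPiAlgebraFin_apply, Finset.prod_const, Finset.card_univ,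
    Fintype.card_fin] at h1 h2
  rw [← h1, ← h2]
  simp only [Finset.sum_range, Finset.sum_mul, smul_mul_assoc]

namespace OpValuedCStarProbSpace

variable {A B : Type*} [CStarAlgebra A] [CStarAlgebra B] {P : OpValuedCStarProbSpace A B}
  {X : ℕ → A} {μ : BPoly B →ₗ[ℂ] B}

/-- Combines the combinatorial limit with the three facts on words: kernel invariance, vanishing at
a single index, and the value on pairings. Crossing pairings have value zero and drop out of the
sum. -/
theorem IsFree.tendsto_monomial (hfree : P.IsFree X) (hid : ∀ i, P.distribution (X i) = μ)
    (hcentred : ∀ i, P.E (X i) = 0) {η : B → B} (hη : η 0 = 0)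
    (hcov : ∀ i b, P.E (X i * P.incl b * X i) = η b) {k : ℕ} (hk : 1 ≤ k) (b : ℕ → B) :
    Filter.Tendsto (fun N : ℕ => P.distribution (normalizedSum X N) (BPoly.monomial k b))
      Filter.atTop (nhds (∑ π ∈ NCPairings k, b 0 * etaPairing η π b * b k)) := by
  have h := tendsto_normalized_sum_pairings hk
    (F := fun i => P.E (segmentWord (fun j => P.incl (b j)) (fun p => X (extendIndex i p)) 0 k))
    (v := fun σ => if σ ∈ NCPairings k then b 0 * etaPairing η σ b * b k else 0) ?_ ?_ ?_
  · rw [Finset.sum_ite_mem, Finset.inter_eq_right.mpr (NCPairings_subset k)] at h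
    refine h.congr fun N => ?_
    have h1 := BPoly.eval_monomial (P.incl : B →ₐ[ℂ] A) (normalizedSum X N) k b
    have h2 : P.distribution (normalizedSum X N) (BPoly.monomial k b)
        = P.E (BPoly.eval (P.incl : B →ₐ[ℂ] A) (normalizedSum X N) (BPoly.monomial k b)) := rfl
    rw [h2, h1]
    have h3 := segmentWord_smul_sum (fun j => P.incl (b j)) X (((√(N : ℝ) : ℝ) : ℂ)⁻¹) N k
    rw [← map_sum, ← map_smul]
    exact congrArg P.E h3.symm
  · intro i i' hi
    refine hfree.E_segmentWord_eq hid b _ _ 0 k fun p hp q hq => ?_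
    rw [zero_add] at hp hq
    have := hi ⟨p, hp.2⟩ ⟨q, hq.2⟩
    simpa [extendIndex, hp.2, hq.2] using this
  · intro i p hp
    refine hfree.E_segmentWord_eq_zero hid hcentred b _ (q := p) (Nat.zero_le _)
      (by rw [zero_add]; exact p.2) fun q _ hq hqp => ?_
    rw [zero_add] at hq
    rw [extendIndex_coe]
    have := hp ⟨q, hq⟩ fun h => hqp (congrArg Fin.val h)
    simpa [extendIndex, hq] using this
  · intro σ hσ i hi
    obtain ⟨hne, hinv⟩ := mem_allPairings.mp hσ
    refine hfree.E_word_pairing hid hcentred hη hcov hk hne hinv b _ fun p q => ?_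
    rw [extendIndex_coe, extendIndex_coe]
    exact hi p q

theorem isSelfAdjoint_normalizedSum (hsa : ∀ i, IsSelfAdjoint (X i)) (N : ℕ) :
    IsSelfAdjoint (normalizedSum X N) := by
  refine IsSelfAdjoint.smul ?_ (isSelfAdjoint_sum _ fun i _ => hsa i)
  rw [isSelfAdjoint_iff, Complex.star_def, map_inv₀, Complex.conj_ofReal]

end OpValuedCStarProbSpace

/-- Operator-valued free central limit theorem. -/
theorem theorem6p2 {A B : Type*} [CStarAlgebra A] [CStarAlgebra B] [PartialOrder B]
    [StarOrderedRing B] (P : OpValuedCStarProbSpace A B) (X : ℕ → A)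
    (hsa : ∀ i, IsSelfAdjoint (X i))
    (hfree : P.IsFree X)
    (hid : ∀ i j, P.distribution (X i) = P.distribution (X j))
    (hcentred : ∀ i, P.E (X i) = 0)
    (η : CompletelyPositiveMap B B)
    (hcov : ∀ i b, P.E (X i * P.incl b * X i) = η b) :
    ∃ ν : BPoly B →ₗ[ℂ] B,
      IsSemicircularDistribution η ν ∧
      (∀ ν' : BPoly B →ₗ[ℂ] B, IsSemicircularDistribution η ν' → ν' = ν) ∧
      (∀ (k : ℕ) (b : ℕ → B), Odd k → ν (BPoly.monomial k b) = 0) ∧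
      ∀ p : BPoly B, Filter.Tendsto
        (fun N : ℕ => P.distribution (OpValuedCStarProbSpace.normalizedSum X N) p)
        Filter.atTop (nhds (ν p)) := by
  have hid' : ∀ i, P.distribution (X i) = P.distribution (X 0) := fun i => hid i 0
  have hdist : ∀ N, IsBDistribution
      (P.distribution (OpValuedCStarProbSpace.normalizedSum X N)) := fun N =>
    P.isBDistribution_distribution (OpValuedCStarProbSpace.isSelfAdjoint_normalizedSum hsa N)
  have hmono : ∀ k b, 1 ≤ k → _ := fun k b hk =>
    hfree.tendsto_monomial hid' hcentred (map_zero η) hcov (k := k) hk b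
  -- Convergence extends from monomials to their span without naming the limit, so no
  -- well-definedness of a moment formula on `B⟨x⟩` has to be checked.
  have hconv : ∀ p : BPoly B, ∃ l, Filter.Tendsto
      (fun N : ℕ => P.distribution (OpValuedCStarProbSpace.normalizedSum X N) p)
      Filter.atTop (nhds l) := by
    intro p
    have hp : p ∈ Submodule.span ℂ {p : BPoly B | ∃ k b, p = BPoly.monomial k b} := by
      rw [BPoly.span_monomial]; trivial
    induction hp using Submodule.span_induction with
    | zero => exact ⟨0, by simp⟩
    | add p q _ _ hp hq =>
      obtain ⟨l, hl⟩ := hp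
      obtain ⟨m, hm⟩ := hq
      exact ⟨l + m, by simpa only [map_add] using hl.add hm⟩
    | smul c p _ hp =>
      obtain ⟨l, hl⟩ := hp
      exact ⟨c • l, by simpa only [map_smul] using hl.const_smul c⟩
    | mem p hp =>
      obtain ⟨k, b, rfl⟩ := hp
      rcases Nat.eq_zero_or_pos k with rfl | hk
      · refine ⟨b 0, ?_⟩
        simp only [BPoly.monomial_zero, (hdist _).map_C]
        exact tendsto_const_nhds
      · exact ⟨_, hmono k b hk⟩
  choose l hl using hconv
  let ν : BPoly B →ₗ[ℂ] B := linearMapOfTendsto l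
    (fun N : ℕ => P.distribution (OpValuedCStarProbSpace.normalizedSum X N))
    (tendsto_pi_nhds.mpr hl)
  have hν : ∀ p, Filter.Tendsto
      (fun N : ℕ => P.distribution (OpValuedCStarProbSpace.normalizedSum X N) p)
      Filter.atTop (nhds (ν p)) := hl
  -- Positivity comes from `ν` being a limit of distributions, the moment formula from uniqueness of
  -- limits.
  have hsemi : IsSemicircularDistribution η ν :=
    (IsBDistribution.of_tendsto hdist hν).isSemicircularDistribution fun k b hk =>
      tendsto_nhds_unique (hν _) (hmono k b hk)
  refine ⟨ν, hsemi, fun ν' hν' => hν'.unique hsemi, fun k b hk => ?_, hν⟩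
  rw [hsemi.moments k b hk.pos, NCPairings_eq_empty hk, Finset.sum_empty]
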